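/- Words are over an alphabet $\Sigma=\{0,\dots,d-1\}$. A substitution is a non-erasing morphism $\Sigma^*\to\Sigma^*$; it is positive if every letter occurs in the image of every letter. A sequence $(\sigma_n)_{n\ge0}$ of substitutions is weakly primitive if for every $n$ some $\sigma_n\cdots\sigma_m$ with $m\ge n$ is positive; it directs $\alpha\in\Sigma^\omega$ if there are infinite words $\alpha^{(n)}$ with $\alpha^{(0)}=\alpha$ and $\sigma_n(\alpha^{(n+1)})=\alpha^{(n)}$ for all $n$. A congenial $S$-adic expansion of $\alpha$ is a sequence $(\sigma_n,a_n)_{n\ge0}$ over $S\times\Sigma$ such that $\sigma_{n+1}(a_{n+1})$ begins with $a_n$ for all $n$ and $\alpha=\lim_n\sigma_0\cdots\sigma_n(a_n)$; here $(\sigma_n)$ is always required to be weakly primitive. Its partial quotients are the pairs $(\pi_n,b_n)_{n\ge0}$ with $\pi_n=\sigma_{k_n}\cdots\sigma_{k_{n+1}-1}$ and $b_n=a_{k_{n+1}-1}$, where $k_0=0$ and $k_{n+1}>k_n$ is the least index for which this composition is positive. Let $L\subseteq\Sigma^\omega$ be recognised by a morphism from $(\Sigma^+,\Sigma^\omega)$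 into a finite $\omega$-semigroup $(F,O)$. Factor $\sigma(a)=b_1v_1\cdots b_rv_r$ with distinct letters $b_i$ and $v_i\in\{b_1,\dots,b_i\}^*$. Write $\sigma\equiv_L\mu$ if for every letter $a$ and every map $h:\Sigma\to F$, extended to a morphism on $\Sigma^*$ by giving the empty word a fresh neutral element as its value, the sequences $\langle(b_1,h(v_1)),\dots,(b_r,h(v_r))\rangle$ obtained from $\sigma(a)$ and from $\mu(a)$ coincide. The set of classes is $\Xi_L$. **Theorem.** There is an algorithm that computes from (a description of) a deterministic parity automaton $\mathcal A$ over an alphabet $\Sigma$ a number $N=N(\mathcal A)$ with the following properties. 1. Let $S$ be any, possibly infinite, set of substitutions over $\Sigma$, let $\mathcal W\subseteq\Sigma^\omega$ be the set of all infinite words directed by a weakly primitive sequence over $S$, and suppose that there is a computable function $p$ such that every $\alpha\in\mathcal W$ has exactly $p(n)$ factors of length $n$, for all $n$. Let $\equiv_L$ be the equivalence for the language $L$ accepted by $\mathcal A$, with respect to any finite $\omega$-semigroup that recognises $L$. If $\alpha,\alpha'\in\mathcal W$ have congenial $S$-adic expansions with partial quotients $(\pi_n,b_n)$ and $(\pi'_n,b'_n)$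 such that $\pi_n\equiv_L\pi'_n$ and $b_n=b'_n$ for all $0\le n<N$, then $\mathcal A$ accepts $\alpha$ if and only if it accepts $\alpha'$. 2. Suppose that $\Sigma=\{0,1\}$. Let $\alpha$ be a Sturmian word of slope $\eta\in(0,1)\setminus\mathbb Q$ and intercept $\chi\in[-\eta,1-\eta]$, that is, $\alpha(n)=\lfloor(n+2)\eta+\chi\rfloor-\lfloor(n+1)\eta+\chi\rfloor$ for all $n\ge 0$, or the same with $\lceil\cdot\rceil$. Let $\eta=[0;a_1,a_2,\dots]$ with convergents $p_n/q_n$ (so $p_0=0$, $q_0=1$), put $\theta_n=q_n\eta-p_n$, and let $\chi=\sum_{n\ge1}b_n\theta_{n-1}$ be the Ostrowski expansion of $\chi$ in base $\eta$ that corresponds to $\alpha$: $0\le b_1<a_1$; $0\le b_n\le a_n$ for all $n$; $b_n=0$ whenever $b_{n+1}=a_{n+1}$; and $\alpha$ is the letterwise limit of the words $n\mapsto\lfloor(n+2)\eta+\chi_k\rfloor-\lfloor(n+1)\eta+\chi_k\rfloor$ with $\chi_k=\sum_{n\le k}b_n\theta_{n-1}$ as $k\to\infty$. (The last condition matters only if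 $n\eta+\chi\in\mathbb Z$ for some $n\ge1$, when two words have the same slope and intercept.) Let $\alpha'$ be another Sturmian word, with digits $a'_n,b'_n$ in the same sense. If $a_n=a'_n$ and $b_n=b'_n$ for all $1\le n\le 6N$, then $\mathcal A$ accepts $\alpha$ if and only if it accepts $\alpha'$. -/

import Mathlib

open Filter Topology

/-! ### Substitutions on finite and infinite words -/

/-- A substitution over `Σ = A`: a non-erasing morphism `A* → A*`, given by the non-empty images of
the letters. -/
@[ext]
structure Substitution (A : Type*) where
  image : A → List A
  image_ne_nil : ∀ a, image a ≠ []

namespace Substitution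

variable {A : Type*}

/-- The image of a finite word. -/
def onWord (σ : Substitution A) (w : List A) : List A := w.flatMap σ.image

theorem length_le_onWord (σ : Substitution A) (w : List A) :
    w.length ≤ (σ.onWord w).length := by
  induction w with
  | nil => simp
  | cons a w ih =>
    have h : 0 < (σ.image a).length := List.length_pos_iff.mpr (σ.image_ne_nil a)
    simp only [onWord, List.flatMap_cons, List.length_append, List.length_cons] at ih ⊢
    omega

/-- The identity substitution. -/
def id (A : Type*) : Substitution A := ⟨fun a => [a], by simp⟩

/-- The composition `σ μ = σ ∘ μ`. -/
def comp (σ μ : Substitution A) : Substitution A where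
  image a := σ.onWord (μ.image a)
  image_ne_nil a h := by
    have h1 := σ.length_le_onWord (μ.image a)
    rw [h] at h1
    exact μ.image_ne_nil a (List.length_eq_zero_iff.mp (Nat.le_zero.mp h1))

/-- The prefix of length `n` of an infinite word. -/
def wordPrefix (α : ℕ → A) (n : ℕ) : List A := List.ofFn fun i : Fin n => α i

/-- The image `σ(α)` of an infinite word: its `i`-th letter can be read off the image of the prefix
of length `i + 1`, because `σ` is non-erasing. -/
def onInfWord (σ : Substitution A) (α : ℕ → A) (i : ℕ) : A :=
  (σ.onWord (wordPrefix α (i + 1)))[i]'(by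
    have h := σ.length_le_onWord (wordPrefix α (i + 1))
    simp only [wordPrefix, List.length_ofFn] at h ⊢
    omega)

/-- `σ` is positive: every letter occurs in the image of every letter. -/
def Positive (σ : Substitution A) : Prop := ∀ b c, b ∈ σ.image c

/-- `block σ i n = σ_i σ_{i+1} ⋯ σ_{i+n-1}`, the composition of `n` terms starting at index `i`. -/
def block (σ : ℕ → Substitution A) (i : ℕ) : ℕ → Substitution A
  | 0 => id A
  | n + 1 => (block σ i n).comp (σ (i + n))

/-- For every `n` there is `m ≥ n` such that `σ_n ⋯ σ_m` is positive. -/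
def WeaklyPrimitive (σ : ℕ → Substitution A) : Prop :=
  ∀ n, ∃ m, n ≤ m ∧ (block σ n (m - n + 1)).Positive

/-- The sequence `σ` directs the infinite word `α`. -/
def Directs (σ : ℕ → Substitution A) (α : ℕ → A) : Prop :=
  ∃ β : ℕ → ℕ → A, β 0 = α ∧ ∀ n, (σ n).onInfWord (β (n + 1)) = β n

/-- `(σ_n, a_n)` generates the infinite word `α`: `α = lim σ_0 ⋯ σ_n(a_n)`. -/
def Generates (σ : ℕ → Substitution A) (a : ℕ → A) (α : ℕ → A) : Prop :=
  ∀ j, ∀ᶠ n in atTop, ((block σ 0 (n + 1)).image (a n)).take j = wordPrefix α j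

/-- `(σ_n, a_n)` is congenial: `σ_{n+1}(a_{n+1})` begins with `a_n`. -/
def Congenial (σ : ℕ → Substitution A) (a : ℕ → A) : Prop :=
  ∀ n, ((σ (n + 1)).image (a (n + 1))).head? = some (a n)

/-- `(σ_n, a_n)` is a weakly primitive and congenial `S`-adic expansion of `α`. -/
structure IsCongenialExpansion (S : Set (Substitution A)) (σ : ℕ → Substitution A) (a : ℕ → A)
    (α : ℕ → A) : Prop where
  mem : ∀ n, σ n ∈ S
  weaklyPrimitive : WeaklyPrimitive σ
  congenial : Congenial σ a
  generates : Generates σ a α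

/-- `(π_n, b_n)` is the sequence of partial quotients of `(σ_n, a_n)`: the directive sequence is cut
greedily, at indices `0 = k_0 < k_1 < ⋯`, into shortest blocks `π_n = σ_{k_n} ⋯ σ_{k_{n+1}-1}` that
are positive, and `b_n` is the letter `a_{k_{n+1}-1}` at the end of the block. -/
def IsPartialQuotients (σ : ℕ → Substitution A) (a : ℕ → A) (π : ℕ → Substitution A)
    (b : ℕ → A) : Prop :=
  ∃ k : ℕ → ℕ, StrictMono k ∧ k 0 = 0 ∧ ∀ n,
    π n = block σ (k n) (k (n + 1) - k n) ∧
    (π n).Positive ∧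
    (∀ r, 0 < r → r < k (n + 1) - k n → ¬ (block σ (k n) r).Positive) ∧
    b n = a (k (n + 1) - 1)

end Substitution

/-- The factor complexity: the number of factors of `α` of length `n`. -/
noncomputable def factorComplexity {A : Type*} (α : ℕ → A) (n : ℕ) : ℕ :=
  (Set.range fun (i : ℕ) (j : Fin n) => α (i + j)).ncard

/-! ### Deterministic parity automata -/

/-- A deterministic parity automaton over the alphabet `{0, …, d-1}`, with states
`{0, …, states-1}`. -/
structure ParityAutomaton (d : ℕ) where
  states : ℕ
  init : Fin states
  step : Fin states → Fin d → Fin states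
  index : Fin states → ℕ

namespace ParityAutomaton

variable {d : ℕ}

/-- The run on an infinite word. -/
def run (M : ParityAutomaton d) (α : ℕ → Fin d) : ℕ → Fin M.states
  | 0 => M.init
  | n + 1 => M.step (M.run α n) (α n)

/-- `α` is accepted if the limit superior of the indices along the run is even. -/
def Accepts (M : ParityAutomaton d) (α : ℕ → Fin d) : Prop :=
  Even (limsup (fun n => M.index (M.run α n)) atTop)

/-- Descriptions of automata that a machine can read: alphabet size, number of states, initial
state, transition table and table of indices. -/
abbrev Code : Type := ℕ × ℕ × ℕ × List (List ℕ) × List ℕ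

/-- The description of an automaton. -/
def code (M : ParityAutomaton d) : Code :=
  (d, M.states, M.init,
    List.ofFn fun q => List.ofFn fun a => (M.step q a : ℕ),
    List.ofFn M.index)

end ParityAutomaton

/-! ### ω-semigroups and the equivalence of substitutions -/

/-- The product `m_i m_{i+1} ⋯ m_{i+n}` in a semigroup. -/
def segmentProd {F : Type*} [Semigroup F] (m : ℕ → F) (i : ℕ) : ℕ → F
  | 0 => m i
  | n + 1 => segmentProd m i n * m (i + (n + 1))

/-- An ω-semigroup `(F, O)`: a semigroup `F`, a mixed product `F × O → O` and an infinite product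
`F^ω → O`, subject to the associativity laws. -/
class OmegaSemigroup (F : Type*) (O : Type*) [Semigroup F] where
  mixed : F → O → O
  iprod : (ℕ → F) → O
  mul_mixed : ∀ (x y : F) (z : O), mixed (x * y) z = mixed x (mixed y z)
  /-- `π(m_0, m_1, …) = π(m_0 ⋯ m_{k_0}, m_{k_0+1} ⋯ m_{k_1}, …)` for strictly increasing `k`. -/
  iprod_group : ∀ (m : ℕ → F) (k : ℕ → ℕ), StrictMono k →
    iprod m = iprod fun n => Nat.casesOn n (segmentProd m 0 (k 0))
      fun i => segmentProd m (k i + 1) (k (i + 1) - (k i + 1))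
  mixed_iprod : ∀ (x : F) (m : ℕ → F),
    mixed x (iprod m) = iprod fun n => Nat.casesOn n x m

section OmegaSemigroup

variable {A F : Type*} [Semigroup F]

/-- The letters `h : A → F` determine a morphism from `(A⁺, A^ω)` to the ω-semigroup `(F, O)`; it
maps `α` to the infinite product of the `h (α n)`. The morphism recognises the language `L` of
infinite words if `L` is the preimage of a set of elements of `O`. -/
def Recognises (O : Type*) [OmegaSemigroup F O] (h : A → F) (L : Set (ℕ → A)) : Prop :=
  ∃ H : Set O, ∀ α : ℕ → A, α ∈ L ↔ OmegaSemigroup.iprod (fun n => h (α n)) ∈ H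

/-- The value `h(v)` of a finite word, where a fresh neutral element is adjoined to `F` as the value
of the empty word. -/
def wordValue (h : A → F) (v : List A) : WithOne F := (v.map fun a => (h a : WithOne F)).prod

variable [DecidableEq A]

/-- Factorisation by first occurrences, relative to a list of letters that have been seen already:
`w = v_0 b_1 v_1 ⋯ b_r v_r` is mapped to `(v_0, [(b_1, v_1), …, (b_r, v_r)])`, where the `b_i` are
the letters not yet seen, at their first occurrences. -/
def splitAux (seen : List A) : List A → List A × List (A × List A)
  | [] => ([], [])
  | c :: w =>
    if c ∈ seen then (c :: (splitAux seen w).1, (splitAux seen w).2)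
    else ([], (c, (splitAux (c :: seen) w).1) :: (splitAux (c :: seen) w).2)

/-- The factorisation `w = b_1 v_1 ⋯ b_r v_r` with distinct letters `b_i` and
`v_i ∈ {b_1, …, b_i}*`, as the list of the pairs `(b_i, v_i)`. -/
def firstOccurrences (w : List A) : List (A × List A) := (splitAux [] w).2

/-- `segments_σ(a, h) = ⟨(b_1, h(v_1)), …, (b_r, h(v_r))⟩`. -/
def segments (σ : Substitution A) (a : A) (h : A → F) : List (A × WithOne F) :=
  (firstOccurrences (σ.image a)).map fun x => (x.1, wordValue h x.2)

/-- The equivalence of substitutions modulo the ω-semigroup: `σ ≡ μ` if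
`segments_σ(a, h) = segments_μ(a, h)` for all letters `a` and all morphisms `h`. (Only the semigroup
`F` of values of finite words enters.) -/
def SegmentEquiv (F : Type*) [Semigroup F] (σ μ : Substitution A) : Prop :=
  ∀ (a : A) (h : A → F), segments σ a h = segments μ a h

end OmegaSemigroup

/-! ### Sturmian words, continued fractions and Ostrowski expansions -/

/-- `α` is a Sturmian word of slope `η` and intercept `χ`. -/
def IsSturmian (η χ : ℝ) (α : ℕ → Fin 2) : Prop :=
  Irrational η ∧ η ∈ Set.Ioo (0 : ℝ) 1 ∧ χ ∈ Set.Icc (-η) (1 - η) ∧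
  ((∀ n : ℕ, ((α n : ℕ) : ℤ) = ⌊((n : ℝ) + 2) * η + χ⌋ - ⌊((n : ℝ) + 1) * η + χ⌋) ∨
   (∀ n : ℕ, ((α n : ℕ) : ℤ) = ⌈((n : ℝ) + 2) * η + χ⌉ - ⌈((n : ℝ) + 1) * η + χ⌉))

/-- `η = [0; a 0, a 1, a 2, …]` (the digits are indexed from `0`). -/
def IsContinuedFraction (η : ℝ) (a : ℕ → ℕ) : Prop :=
  (GenContFract.of η).h = 0 ∧ ∀ n, (GenContFract.of η).partDens.get? n = some (a n : ℝ)

/-- `θ_n = q_n η - p_n`, where `p_n / q_n` are the convergents of `η`. -/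
noncomputable def theta (η : ℝ) (n : ℕ) : ℝ :=
  (GenContFract.of η).dens n * η - (GenContFract.of η).nums n

/-- `b_1 θ_0 + ⋯ + b_n θ_{n-1}` (the digit `b_{i+1}` is `b i`). -/
noncomputable def ostrowskiSum (η : ℝ) (b : ℕ → ℕ) (n : ℕ) : ℝ :=
  ∑ i ∈ Finset.range n, (b i : ℝ) * theta η i

/-- `b` is an Ostrowski expansion of `χ` in base `η = [0; a 0, a 1, …]`. -/
structure IsOstrowskiExpansion (η : ℝ) (a : ℕ → ℕ) (χ : ℝ) (b : ℕ → ℕ) : Prop where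
  first : b 0 < a 0
  le : ∀ n, b n ≤ a n
  eq_zero : ∀ n, b (n + 1) = a (n + 1) → b n = 0
  sum : Tendsto (ostrowskiSum η b) atTop (𝓝 χ)

/-- `α` is the Sturmian word of slope `η` that corresponds to the Ostrowski expansion `b`: the
letterwise limit of the words of slope `η` whose intercepts are the partial sums of the expansion.
If only one word has slope `η` and the intercept `χ` represented by `b`, then this is that word.
Otherwise (`n η + χ` is an integer for some `n ≥ 1`) two words have this slope and intercept, and
the limit singles out one of them. -/
def Corresponds (η : ℝ) (b : ℕ → ℕ) (α : ℕ → Fin 2) : Prop :=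
  ∀ m : ℕ, ∀ᶠ n in atTop, ((α m : ℕ) : ℤ) =
    ⌊((m : ℝ) + 2) * η + ostrowskiSum η b n⌋ - ⌊((m : ℝ) + 1) * η + ostrowskiSum η b n⌋

/-- `α` is a Sturmian word of slope `η = [0; a 0, a 1, …]` and intercept `χ`, and `b` is the
corresponding Ostrowski expansion of `χ` in base `η`. -/
structure IsSturmianWithDigits (η χ : ℝ) (a b : ℕ → ℕ) (α : ℕ → Fin 2) : Prop where
  sturmian : IsSturmian η χ α
  continuedFraction : IsContinuedFraction η a
  ostrowski : IsOstrowskiExpansion η a χ b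
  corresponds : Corresponds η b α

/-! The profile of a finite word is its effect on the automaton: for each state, the state reached
and the set of states visited. There are finitely many profiles. The number N exceeds by one the
number of triples consisting of two families of profiles indexed by the letters and one letter.
Hence there are i < j < N such that π_0⋯π_i and π_0⋯π_j give each letter images with the same
profile, b_i = b_j, and the same holds for the second expansion with the same i, j. Put ρ = π_0⋯π_i,
κ = π_{i+1}⋯π_j and b = b_i. Then α = ρκ(β) for a word β that begins with b, and κ(b) begins with b,
so that κ has a fixed point ω = κ^ω(b).

The heart of the proof is that the automaton does not distinguish α from ρ(ω) (`accepts_iff_fixed`).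
Since ρκ and ρ have the same effect, β may be replaced by κⁿ(β). This word shares a long prefix with
ω and has the same complexity, so for large n it has the same factors of a given length as ω. Both
words can therefore be cut at occurrences of b into factors of ω. The profiles of the ρ-images of
such factors generate a semigroup in which each element is a left divisor of each element
(`rightSimple_closure_returnProfiles`). In such a semigroup all the factors but the first visit one
and the same set of states, whatever the sequence of factors is (`Profile.exists_visited_eq`).

It remains to compare ρ(ω) with its counterpart ρ'(ω'). If κ(b) = bu, then ρ(ω) is the product of
ρ(b), ρ(u), ρκ(u), ρκ²(u), …. Equivalent substitutions give images with the same first letter and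
remaining parts of the same value, and this relation is compatible with composition. So the two
infinite products agree (`iprod_fixed_eq`).

A Sturmian word is directed by the substitutions 0 ↦ 0^{a-b} 1 0^b, 1 ↦ 0 given by its digits, with
the first partial quotient decreased by one. Equal digits give the same ρ and κ for both words,
hence the same ω. In place of the complexity, the factors of length two are used: 11 does not occur
in β, and 00, 01, 10 all occur in ω, so long factors of κⁿ(β) occur in ω. -/

theorem StrictMono.exists_le_lt_succ {k : ℕ → ℕ} (hk : StrictMono k) (h0 : k 0 = 0) (n : ℕ) :
    ∃ i, k i ≤ n ∧ n < k (i + 1) := by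
  have hex : ∃ r, n < k r := ⟨n + 1, hk.le_apply⟩
  have hs := Nat.find_spec hex
  have hne : Nat.find hex ≠ 0 := by
    intro h
    rw [h, h0] at hs
    omega
  obtain ⟨r, hr⟩ := Nat.exists_eq_succ_of_ne_zero hne
  rw [hr] at hs
  exact ⟨r, not_lt.mp (Nat.find_min hex (m := r) (by omega)), hs⟩

namespace Substitution

variable {A : Type*}

/-! ### Finite words -/

@[simp] theorem onWord_nil (σ : Substitution A) : σ.onWord [] = [] := rfl

@[simp] theorem onWord_singleton (σ : Substitution A) (a : A) : σ.onWord [a] = σ.image a := by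
  simp [onWord]

theorem onWord_cons (σ : Substitution A) (a : A) (w : List A) :
    σ.onWord (a :: w) = σ.image a ++ σ.onWord w := rfl

@[simp] theorem onWord_append (σ : Substitution A) (v w : List A) :
    σ.onWord (v ++ w) = σ.onWord v ++ σ.onWord w := by
  simp [onWord]

@[simp] theorem id_image (a : A) : (id A).image a = [a] := rfl

@[simp] theorem id_onWord (w : List A) : (id A).onWord w = w := by
  simp [onWord, id]

theorem comp_onWord (σ μ : Substitution A) (w : List A) :
    (σ.comp μ).onWord w = σ.onWord (μ.onWord w) := by
  simp only [onWord, comp, List.flatMap_assoc]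

theorem comp_image (σ μ : Substitution A) (a : A) :
    (σ.comp μ).image a = σ.onWord (μ.image a) := rfl

theorem comp_assoc (σ μ ν : Substitution A) : (σ.comp μ).comp ν = σ.comp (μ.comp ν) := by
  ext1
  funext a
  simp only [comp_image, comp_onWord]

@[simp] theorem id_comp (σ : Substitution A) : (id A).comp σ = σ := by
  ext1
  funext a
  simp [comp_image]

@[simp] theorem comp_id (σ : Substitution A) : σ.comp (id A) = σ := by
  ext1
  funext a
  simp [comp_image, id]

theorem length_image_pos (σ : Substitution A) (a : A) : 0 < (σ.image a).length :=
  List.length_pos_iff.mpr (σ.image_ne_nil a)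

theorem onWord_ne_nil (σ : Substitution A) {w : List A} (hw : w ≠ []) : σ.onWord w ≠ [] := by
  have h := σ.length_le_onWord w
  rw [← List.length_pos_iff] at hw ⊢
  omega

theorem mem_onWord {σ : Substitution A} {w : List A} {b : A} :
    b ∈ σ.onWord w ↔ ∃ a ∈ w, b ∈ σ.image a := by
  simp [onWord]

theorem block_zero (s : ℕ → Substitution A) (i : ℕ) : block s i 0 = id A := rfl

theorem block_succ (s : ℕ → Substitution A) (i n : ℕ) :
    block s i (n + 1) = (block s i n).comp (s (i + n)) := rfl

theorem block_add (s : ℕ → Substitution A) (i m n : ℕ) :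
    block s i (m + n) = (block s i m).comp (block s (i + m) n) := by
  induction n with
  | zero => simp [block_zero]
  | succ n ih => rw [← Nat.add_assoc, block_succ, ih, block_succ, comp_assoc, Nat.add_assoc]

theorem block_one (s : ℕ → Substitution A) (i : ℕ) : block s i 1 = s i := by
  simp [block_succ, block_zero]

theorem block_succ' (s : ℕ → Substitution A) (i n : ℕ) :
    block s i (n + 1) = (s i).comp (block s (i + 1) n) := by
  rw [Nat.add_comm n 1, block_add, block_one]

theorem block_congr {s t : ℕ → Substitution A} {i j n : ℕ}
    (h : ∀ r < n, s (i + r) = t (j + r)) : block s i n = block t j n := by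
  induction n with
  | zero => rfl
  | succ n ih =>
    rw [block_succ, block_succ, ih fun r hr => h r (by omega), h n (by omega)]

/-- The `n`-th power of a substitution. -/
def pow (κ : Substitution A) (n : ℕ) : Substitution A := block (fun _ => κ) 0 n

theorem pow_zero (κ : Substitution A) : κ.pow 0 = id A := rfl

theorem pow_succ (κ : Substitution A) (n : ℕ) : κ.pow (n + 1) = (κ.pow n).comp κ := rfl

theorem pow_succ' (κ : Substitution A) (n : ℕ) : κ.pow (n + 1) = κ.comp (κ.pow n) := by
  rw [pow, block_succ']
  congr 1
  exact block_congr fun _ _ => rfl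

/-! ### Positivity -/

/-- Every letter occurs in the image of some letter. -/
def Covering (σ : Substitution A) : Prop := ∀ b, ∃ a, b ∈ σ.image a

theorem Covering.comp {σ μ : Substitution A} (hσ : σ.Covering) (hμ : μ.Covering) :
    (σ.comp μ).Covering := by
  intro b
  obtain ⟨a, ha⟩ := hσ b
  obtain ⟨c, hc⟩ := hμ a
  exact ⟨c, mem_onWord.mpr ⟨a, hc, ha⟩⟩

theorem covering_id : (id A).Covering := fun b => ⟨b, by simp [id]⟩

theorem Covering.comp_positive {σ μ : Substitution A} (hσ : σ.Covering) (hμ : μ.Positive) :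
    (σ.comp μ).Positive := by
  intro b c
  obtain ⟨a, ha⟩ := hσ b
  exact mem_onWord.mpr ⟨a, hμ a c, ha⟩

theorem Positive.comp {σ : Substitution A} (hσ : σ.Positive) (μ : Substitution A) :
    (σ.comp μ).Positive := by
  intro b c
  exact mem_onWord.mpr ⟨_, List.head_mem (μ.image_ne_nil c), hσ b _⟩

theorem Covering.of_comp {σ μ : Substitution A} (h : (σ.comp μ).Positive) : σ.Covering := by
  intro b
  obtain ⟨a, -, ha⟩ := mem_onWord.mp (h b b)
  exact ⟨a, ha⟩

/-- The outermost factor of a positive composition reaches every letter. This is what allows a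
member of the sequence to be put in front of another weakly primitive sequence. -/
theorem WeaklyPrimitive.covering {s : ℕ → Substitution A} (h : WeaklyPrimitive s) (n : ℕ) :
    (s n).Covering := by
  obtain ⟨m, -, hp⟩ := h n
  rw [block_succ'] at hp
  exact Covering.of_comp hp

theorem Covering.block {s : ℕ → Substitution A} {i n : ℕ} (h : ∀ r < n, (s (i + r)).Covering) :
    (block s i n).Covering := by
  induction n with
  | zero => exact covering_id
  | succ n ih => exact (ih fun r hr => h r (by omega)).comp (h n (by omega))

theorem WeaklyPrimitive.shift {s : ℕ → Substitution A} (h : WeaklyPrimitive s) (k : ℕ) :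
    WeaklyPrimitive fun n => s (k + n) := by
  intro n
  obtain ⟨m, hm, hp⟩ := h (k + n)
  refine ⟨m - k, by omega, ?_⟩
  rw [block_congr (t := s) (j := k + n) fun r _ => by rw [Nat.add_assoc]]
  convert hp using 2
  omega

theorem Positive.two_le_length [Nontrivial A] {σ : Substitution A} (h : σ.Positive) (a : A) :
    2 ≤ (σ.image a).length := by
  obtain ⟨x, y, hxy⟩ := exists_pair_ne A
  by_contra hlt
  have h1 := σ.length_image_pos a
  obtain ⟨z, hz⟩ := List.length_eq_one_iff.mp (show (σ.image a).length = 1 by omega)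
  have hx := h x a
  have hy := h y a
  rw [hz, List.mem_singleton] at hx hy
  exact hxy (hx.trans hy.symm)

theorem mul_length_le_onWord {σ : Substitution A} {L : ℕ} (h : ∀ a, L ≤ (σ.image a).length)
    (w : List A) : w.length * L ≤ (σ.onWord w).length := by
  induction w with
  | nil => simp
  | cons a w ih =>
    rw [onWord_cons, List.length_append, List.length_cons, Nat.add_mul]
    have := h a
    omega

theorem Positive.lt_length_pow [Nontrivial A] {κ : Substitution A} (h : κ.Positive) (n : ℕ)
    (a : A) : n < ((κ.pow n).image a).length := by
  induction n generalizing a with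
  | zero => exact length_image_pos _ a
  | succ n ih =>
    rw [pow_succ, comp_image]
    have h1 := mul_length_le_onWord (σ := κ.pow n) (L := n + 1) ih (κ.image a)
    have h2 := h.two_le_length a
    have h3 := Nat.mul_le_mul_right (n + 1) h2
    omega

theorem length_block_mono (s : ℕ → Substitution A) (i : ℕ) {m n L : ℕ} (hmn : m ≤ n)
    (h : ∀ a, L ≤ ((block s i m).image a).length) (a : A) :
    L ≤ ((block s i n).image a).length := by
  obtain ⟨r, rfl⟩ := Nat.exists_eq_add_of_le hmn
  rw [block_add, comp_image]
  have h1 := mul_length_le_onWord h ((block s (i + m) r).image a)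
  have h2 := Nat.mul_le_mul_right L (length_image_pos (block s (i + m) r) a)
  omega

theorem WeaklyPrimitive.exists_length [Nontrivial A] {s : ℕ → Substitution A}
    (h : WeaklyPrimitive s) (i L : ℕ) :
    ∃ m, ∀ n ≥ m, ∀ a, L ≤ ((block s i n).image a).length := by
  suffices H : ∃ m, ∀ a, L ≤ ((block s i m).image a).length by
    obtain ⟨m, hm⟩ := H
    exact ⟨m, fun n hn => length_block_mono s i hn hm⟩
  induction L with
  | zero => exact ⟨0, by simp⟩
  | succ L ih =>
    obtain ⟨m, hm⟩ := ih
    obtain ⟨k, -, hp⟩ := h (i + m)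
    refine ⟨m + (k - (i + m) + 1), fun a => ?_⟩
    rw [block_add, comp_image]
    have h2 := hp.two_le_length a
    -- A positive block doubles the lower bound for the lengths. The maximum with 1 makes doubling a
    -- strict increase also for `L = 0`.
    have h1 := mul_length_le_onWord (σ := block s i m) (L := max L 1) (fun c =>
      max_le (hm c) (length_image_pos _ c)) ((block s (i + m) (k - (i + m) + 1)).image a)
    have h3 := Nat.mul_le_mul_right (max L 1) h2
    omega

/-! ### Prefixes and factors of infinite words -/

/-- The factor `α(i) ⋯ α(j - 1)` of an infinite word. -/
def seg (α : ℕ → A) (i j : ℕ) : List A := (List.Ico i j).map α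

@[simp] theorem length_seg (α : ℕ → A) (i j : ℕ) : (seg α i j).length = j - i := by simp [seg]

theorem seg_append (α : ℕ → A) {i j k : ℕ} (hij : i ≤ j) (hjk : j ≤ k) :
    seg α i j ++ seg α j k = seg α i k := by
  simp only [seg, ← List.map_append, List.Ico.append_consecutive hij hjk]

@[simp] theorem seg_self (α : ℕ → A) (i : ℕ) : seg α i i = [] := by simp [seg]

@[simp] theorem seg_succ_self (α : ℕ → A) (i : ℕ) : seg α i (i + 1) = [α i] := by
  simp [seg]

theorem seg_succ (α : ℕ → A) {i j : ℕ} (h : i ≤ j) : seg α i (j + 1) = seg α i j ++ [α j] := by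
  rw [← seg_append α h (Nat.le_succ j), Nat.succ_eq_add_one, seg_succ_self]

theorem seg_eq_ofFn (α : ℕ → A) (i n : ℕ) :
    seg α i (i + n) = List.ofFn fun j : Fin n => α (i + j) := by
  induction n with
  | zero => simp
  | succ n ih =>
    rw [← Nat.add_assoc, seg_succ α (Nat.le_add_right i n), ih, List.ofFn_succ_last]
    simp

theorem wordPrefix_eq_seg (α : ℕ → A) (n : ℕ) : wordPrefix α n = seg α 0 n := by
  have := seg_eq_ofFn α 0 n
  simp only [Nat.zero_add] at this
  exact this.symm

theorem getElem?_seg (α : ℕ → A) {i j r : ℕ} (h : i + r < j) : (seg α i j)[r]? = some (α (i + r)) := by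
  obtain ⟨n, rfl⟩ : ∃ n, j = i + n := ⟨j - i, by omega⟩
  rw [seg_eq_ofFn, List.getElem?_ofFn]
  simp [show r < n by omega]

theorem seg_eq_seg_iff {α β : ℕ → A} {i j n : ℕ} :
    seg α i (i + n) = seg β j (j + n) ↔ ∀ r < n, α (i + r) = β (j + r) := by
  rw [seg_eq_ofFn, seg_eq_ofFn, List.ofFn_inj, funext_iff, Fin.forall_iff]

/-- The finite word `w` is a prefix of the infinite word `α`. -/
def IsPrefixOf (w : List A) (α : ℕ → A) : Prop := seg α 0 w.length = w

theorem isPrefixOf_seg (α : ℕ → A) (n : ℕ) : IsPrefixOf (seg α 0 n) α := by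
  simp [IsPrefixOf]

theorem isPrefixOf_iff {w : List A} {α : ℕ → A} :
    IsPrefixOf w α ↔ ∀ i < w.length, w[i]? = some (α i) := by
  constructor
  · intro h i hi
    rw [← h, getElem?_seg α (by simpa using hi), Nat.zero_add]
  · intro h
    apply List.ext_getElem?
    intro i
    by_cases hi : i < w.length
    · rw [getElem?_seg α (by simpa using hi), h i hi, Nat.zero_add]
    · rw [List.getElem?_eq_none (by simpa using hi), List.getElem?_eq_none (by simpa using hi)]

theorem IsPrefixOf.of_prefix {v w : List A} {α : ℕ → A} (h : IsPrefixOf w α) (hv : v <+: w) :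
    IsPrefixOf v α := by
  rw [isPrefixOf_iff] at h ⊢
  intro i hi
  rw [← h i (hi.trans_le hv.length_le)]
  obtain ⟨t, rfl⟩ := hv
  rw [List.getElem?_append_left hi]

theorem IsPrefixOf.prefix_of_le {v w : List A} {α : ℕ → A} (hv : IsPrefixOf v α)
    (hw : IsPrefixOf w α) (h : v.length ≤ w.length) : v <+: w := by
  rw [← hv, ← hw, ← seg_append α (Nat.zero_le _) h]
  exact List.prefix_append _ _

theorem isPrefixOf_singleton {a : A} {α : ℕ → A} : IsPrefixOf [a] α ↔ α 0 = a := by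
  simp [IsPrefixOf]

theorem IsPrefixOf.apply_zero {w : List A} {α : ℕ → A} {a : A} (h : IsPrefixOf w α)
    (ha : w.head? = some a) : α 0 = a := by
  rw [isPrefixOf_iff] at h
  cases w with
  | nil => simp at ha
  | cons c w =>
    obtain rfl : c = a := by simpa using ha
    simpa using (h 0 (by simp)).symm

/-- Extensionality in the form used below: images of infinite words are controlled through their
prefixes, not letter by letter. -/
theorem eq_of_isPrefixOf {α β : ℕ → A}
    (h : ∀ L, ∃ w : List A, L ≤ w.length ∧ IsPrefixOf w α ∧ IsPrefixOf w β) : α = β := by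
  funext i
  obtain ⟨w, hw, h1, h2⟩ := h (i + 1)
  rw [isPrefixOf_iff] at h1 h2
  exact Option.some_injective _ ((h1 i hw).symm.trans (h2 i hw))

theorem exists_isPrefixOf {w : ℕ → List A} (hw : ∀ n, w n <+: w (n + 1))
    (hlen : ∀ L, ∃ n, L ≤ (w n).length) : ∃ α : ℕ → A, ∀ n, IsPrefixOf (w n) α := by
  have hmono : ∀ m n, m ≤ n → w m <+: w n := fun m n hmn =>
    Nat.le_induction (List.prefix_refl _) (fun n _ ih => ih.trans (hw n)) n hmn
  choose f hf using fun i => hlen (i + 1)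
  refine ⟨fun i => (w (f i))[i]'(hf i), fun n => isPrefixOf_iff.mpr fun i hi => ?_⟩
  rw [← List.getElem?_eq_getElem]
  rcases le_total n (f i) with h | h
  · obtain ⟨t, ht⟩ := hmono _ _ h
    rw [← ht, List.getElem?_append_left hi]
  · obtain ⟨t, ht⟩ := hmono _ _ h
    rw [← ht, List.getElem?_append_left (hf i)]

/-! ### Images of infinite words -/

theorem length_onWord_seg_lt (σ : Substitution A) (α : ℕ → A) {i j : ℕ} (h : i < j) :
    (σ.onWord (seg α 0 i)).length < (σ.onWord (seg α 0 j)).length := by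
  rw [← seg_append α (Nat.zero_le i) h.le, onWord_append, List.length_append]
  have := σ.length_le_onWord (seg α i j)
  rw [length_seg] at this
  omega

/-- This property characterises `onInfWord`; what follows rests on it and not on the definition by
indices. -/
theorem IsPrefixOf.onWord {w : List A} {α : ℕ → A} (σ : Substitution A) (h : IsPrefixOf w α) :
    IsPrefixOf (σ.onWord w) (σ.onInfWord α) := by
  rw [isPrefixOf_iff]
  intro i hi
  have hlen := σ.length_le_onWord (wordPrefix α (i + 1))
  have hwp : (wordPrefix α (i + 1)).length = i + 1 := by simp [wordPrefix]
  have hi' : i < (σ.onWord (wordPrefix α (i + 1))).length := by omega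
  rw [onInfWord, ← List.getElem?_eq_getElem hi']
  have hp : IsPrefixOf (wordPrefix α (i + 1)) α := by
    rw [wordPrefix_eq_seg]
    exact isPrefixOf_seg α _
  rcases le_total w.length (wordPrefix α (i + 1)).length with hle | hle
  · obtain ⟨t, ht⟩ := h.prefix_of_le hp hle
    rw [← ht, onWord_append, List.getElem?_append_left hi]
  · obtain ⟨t, ht⟩ := hp.prefix_of_le h hle
    rw [← ht, onWord_append, List.getElem?_append_left hi']

theorem comp_onInfWord (σ μ : Substitution A) (α : ℕ → A) :
    (σ.comp μ).onInfWord α = σ.onInfWord (μ.onInfWord α) := by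
  refine eq_of_isPrefixOf fun L => ⟨(σ.comp μ).onWord (seg α 0 L), ?_, ?_, ?_⟩
  · simpa using (σ.comp μ).length_le_onWord (seg α 0 L)
  · exact (isPrefixOf_seg α L).onWord _
  · rw [comp_onWord]
    exact ((isPrefixOf_seg α L).onWord _).onWord _

@[simp] theorem id_onInfWord (α : ℕ → A) : (id A).onInfWord α = α := by
  refine eq_of_isPrefixOf fun L => ⟨seg α 0 L, by simp, ?_, isPrefixOf_seg α L⟩
  simpa using (isPrefixOf_seg α L).onWord (id A)

/-- The position at which the image of the letter `α i` starts in `σ(α)`. -/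
def cut (σ : Substitution A) (α : ℕ → A) (i : ℕ) : ℕ := (σ.onWord (seg α 0 i)).length

@[simp] theorem cut_zero (σ : Substitution A) (α : ℕ → A) : σ.cut α 0 = 0 := by simp [cut]

theorem cut_strictMono (σ : Substitution A) (α : ℕ → A) : StrictMono (σ.cut α) :=
  fun _ _ h => σ.length_onWord_seg_lt α h

theorem cut_add (σ : Substitution A) (α : ℕ → A) {i j : ℕ} (h : i ≤ j) :
    σ.cut α j = σ.cut α i + (σ.onWord (seg α i j)).length := by
  rw [cut, cut, ← List.length_append, ← onWord_append, seg_append α (Nat.zero_le i) h]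

theorem seg_cut (σ : Substitution A) (α : ℕ → A) {i j : ℕ} (h : i ≤ j) :
    seg (σ.onInfWord α) (σ.cut α i) (σ.cut α j) = σ.onWord (seg α i j) := by
  have hj : seg (σ.onInfWord α) 0 (σ.cut α j) = σ.onWord (seg α 0 j) :=
    (isPrefixOf_seg α j).onWord σ
  have hi : seg (σ.onInfWord α) 0 (σ.cut α i) = σ.onWord (seg α 0 i) :=
    (isPrefixOf_seg α i).onWord σ
  rw [← seg_append _ (Nat.zero_le _) ((σ.cut_strictMono α).monotone h), hi,
    ← seg_append α (Nat.zero_le i) h, onWord_append] at hj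
  exact List.append_cancel_left hj

theorem pow_onInfWord_of_fixed {κ : Substitution A} {ω : ℕ → A} (h : κ.onInfWord ω = ω) (n : ℕ) :
    (κ.pow n).onInfWord ω = ω := by
  induction n with
  | zero => simp [pow_zero]
  | succ n ih => rw [pow_succ, comp_onInfWord, h, ih]

theorem onInfWord_apply_zero {σ : Substitution A} {α : ℕ → A} {a : A}
    (h : (σ.image (α 0)).head? = some a) : σ.onInfWord α 0 = a := by
  have h1 := ((isPrefixOf_singleton (α := α)).mpr rfl).onWord σ
  rw [onWord_singleton] at h1
  exact h1.apply_zero h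

theorem head?_onWord {σ : Substitution A} {w : List A} {a b : A} (hw : w.head? = some a)
    (ha : (σ.image a).head? = some b) : (σ.onWord w).head? = some b := by
  cases w with
  | nil => simp at hw
  | cons c w =>
    obtain rfl : c = a := by simpa using hw
    rw [onWord_cons, List.head?_append, ha]
    rfl

theorem prefix_onWord {σ : Substitution A} {w : List A} {a : A} (hw : w.head? = some a) :
    σ.image a <+: σ.onWord w := by
  cases w with
  | nil => simp at hw
  | cons c w =>
    obtain rfl : c = a := by simpa using hw
    exact List.prefix_append _ _

theorem head?_pow {κ : Substitution A} {b : A} (h : (κ.image b).head? = some b) (n : ℕ) :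
    ((κ.pow n).image b).head? = some b := by
  induction n with
  | zero => simp [pow_zero, id]
  | succ n ih => exact head?_onWord h ih

/-- A positive substitution whose image of `b` begins with `b` has a fixed point that begins
with `b`. -/
theorem exists_fixed [Nontrivial A] {κ : Substitution A} (hκ : κ.Positive) {b : A}
    (h : (κ.image b).head? = some b) :
    ∃ ω : ℕ → A, κ.onInfWord ω = ω ∧ ω 0 = b ∧ ∀ n, IsPrefixOf ((κ.pow n).image b) ω := by
  obtain ⟨ω, hω⟩ := exists_isPrefixOf (w := fun n => (κ.pow n).image b)
    (fun n => by
      rw [pow_succ, comp_image]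
      exact prefix_onWord h)
    (fun L => ⟨L, (hκ.lt_length_pow L b).le⟩)
  refine ⟨ω, ?_, (hω 0).apply_zero rfl, hω⟩
  refine eq_of_isPrefixOf fun L => ⟨(κ.pow (L + 1)).image b, ?_, ?_, hω _⟩
  · have := hκ.lt_length_pow (L + 1) b
    omega
  · rw [pow_succ', comp_image]
    exact (hω L).onWord κ

/-- Each letter occurs with bounded gaps in the image of an infinite word under a positive
substitution. -/
theorem Positive.exists_gap [Finite A] {κ : Substitution A} (hκ : κ.Positive) (b : A) :
    ∃ m, ∀ (α : ℕ → A) (i : ℕ), ∃ j, i < j ∧ j ≤ i + m ∧ κ.onInfWord α j = b := by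
  obtain ⟨m, hm⟩ : ∃ m, ∀ a, (κ.image a).length ≤ m := by
    obtain ⟨m, hm⟩ := (Set.finite_range fun a => (κ.image a).length).bddAbove
    exact ⟨m, fun a => hm ⟨a, rfl⟩⟩
  -- The position `i` lies in the image of some letter; the image of the next letter contains `b`.
  -- Both images have length at most `m`.
  refine ⟨2 * m, fun α i => ?_⟩
  obtain ⟨r, hr1, hr2⟩ := (κ.cut_strictMono α).exists_le_lt_succ (κ.cut_zero α) i
  have h1 := κ.cut_add α (Nat.le_succ r)
  have h2 := κ.cut_add α (Nat.le_succ (r + 1))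
  have h3 := κ.seg_cut α (Nat.le_succ (r + 1))
  simp only [Nat.succ_eq_add_one, seg_succ_self, onWord_singleton] at h1 h2 h3
  have hb := hκ b (α (r + 1))
  rw [← h3, List.mem_iff_getElem?] at hb
  obtain ⟨t, ht⟩ := hb
  have hlt : t < κ.cut α (r + 1 + 1) - κ.cut α (r + 1) := by
    by_contra hge
    rw [List.getElem?_eq_none (by rw [length_seg]; omega)] at ht
    simp at ht
  rw [getElem?_seg _ (by omega)] at ht
  have hm1 := hm (α r)
  have hm2 := hm (α (r + 1))
  exact ⟨κ.cut α (r + 1) + t, by omega, by omega, by simpa using ht⟩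

end Substitution

section

open Substitution

/-! ### Semigroups in which every principal right ideal is everything -/

/-- The subsemigroup generated by a subset `E` of a finite monoid is right simple, provided that
`E` satisfies the following: each `x ∈ E` occurs in a common initial part `y x` of all the elements
of `E`. -/
theorem Subsemigroup.exists_eq_mul_of_mem_closure {P : Type*} [Monoid P] [Finite P] {E : Set P}
    (hE : ∀ x ∈ E, ∃ y, (y = 1 ∨ y ∈ E) ∧ ∀ e ∈ E, ∃ z ∈ E, e = y * x * z) :
    ∀ s ∈ closure E, ∀ t ∈ closure E, ∃ u ∈ closure E, t = s * u := by
  intro s hs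
  induction hs using closure_induction with
  | mem x hx =>
    obtain ⟨y, hy, hE⟩ := hE x hx
    have hx' : x ∈ closure E := subset_closure hx
    have hT : ∀ t ∈ closure E, ∃ u ∈ closure E, t = y * x * u := by
      intro t ht
      induction ht using closure_induction with
      | mem e he =>
        obtain ⟨z, hz, h⟩ := hE e he
        exact ⟨z, subset_closure hz, h⟩
      | mul a b _ hb iha _ =>
        obtain ⟨u, hu, rfl⟩ := iha
        exact ⟨u * b, mul_mem hu hb, by simp only [mul_assoc]⟩
    have hy' : ∀ t ∈ closure E, y * t ∈ closure E := by
      rcases hy with rfl | hy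
      · simp
      · exact fun t ht => mul_mem (subset_closure hy) ht
    let f : closure E → closure E := fun u => ⟨x * u, mul_mem hx' u.2⟩
    let g : closure E → closure E := fun u => ⟨y * u, hy' u u.2⟩
    -- Left multiplication by `y x` is onto, hence bijective by finiteness. So left multiplication
    -- by `x` is injective, and again by finiteness it is onto.
    have hgf : Function.Surjective (g ∘ f) := by
      rintro ⟨t, ht⟩
      obtain ⟨u, hu, rfl⟩ := hT t ht
      exact ⟨⟨u, hu⟩, Subtype.ext (mul_assoc _ _ _).symm⟩
    have hf : Function.Surjective f :=
      Finite.surjective_of_injective (Finite.injective_iff_surjective.mpr hgf).of_comp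
    intro t ht
    obtain ⟨u, hu⟩ := hf ⟨t, ht⟩
    exact ⟨u, u.2, (congrArg Subtype.val hu).symm⟩
  | mul a b _ _ iha ihb =>
    intro t ht
    obtain ⟨u, hu, rfl⟩ := iha t ht
    obtain ⟨v, hv, rfl⟩ := ihb u hu
    exact ⟨v, hv, (mul_assoc _ _ _).symm⟩

/-! ### Profiles of finite words -/

/-- The effect of a finite word on an automaton with state set `Q`: it maps a state to the state
that is reached from it, together with the set of states that are visited on the way (the last one
excluded). -/
@[ext]
structure Profile (Q : Type*) where
  toFun : Q → Q × Finset Q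

namespace Profile

variable {Q : Type*}

instance [Finite Q] : Finite (Profile Q) :=
  Finite.of_injective toFun fun _ _ => Profile.ext

/-- Profiles are functions. -/
def equiv (Q : Type*) : Profile Q ≃ (Q → Q × Finset Q) := ⟨toFun, mk, fun _ => rfl, fun _ => rfl⟩

variable [DecidableEq Q]

/-- Multiplication follows the reading order. Leaving out the last state makes the visited sets of
consecutive words combine by union, with the empty set for the empty word. -/
instance : Monoid (Profile Q) where
  mul f g := ⟨fun q => ((g.toFun (f.toFun q).1).1, (f.toFun q).2 ∪ (g.toFun (f.toFun q).1).2)⟩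
  one := ⟨fun q => (q, ∅)⟩
  mul_assoc f g h := by
    ext1
    funext q
    exact Prod.ext rfl (Finset.union_assoc _ _ _)
  one_mul f := by
    ext1
    funext q
    exact Prod.ext rfl (Finset.empty_union _)
  mul_one f := by
    ext1
    funext q
    exact Prod.ext rfl (Finset.union_empty _)

theorem one_toFun (q : Q) : (1 : Profile Q).toFun q = (q, ∅) := rfl

theorem mul_toFun_fst (f g : Profile Q) (q : Q) :
    ((f * g).toFun q).1 = (g.toFun (f.toFun q).1).1 := rfl

theorem mul_toFun_snd (f g : Profile Q) (q : Q) :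
    ((f * g).toFun q).2 = (f.toFun q).2 ∪ (g.toFun (f.toFun q).1).2 := rfl

/-- The run of a sequence of profiles. -/
def run (m : ℕ → Profile Q) (q : Q) : ℕ → Q
  | 0 => q
  | n + 1 => ((m n).toFun (run m q n)).1

/-- In a right simple semigroup of profiles, all the products but the first visit the same states,
which depend only on the initial state. -/
theorem exists_visited_eq {T : Subsemigroup (Profile Q)}
    (hT : ∀ s ∈ T, ∀ t ∈ T, ∃ u ∈ T, t = s * u) (q : Q) :
    ∃ I : Finset Q, ∀ m : ℕ → Profile Q, (∀ i, m i ∈ T) →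
      ∀ i, 1 ≤ i → ((m i).toFun (run m q i)).2 = I := by
  -- If `t = s u`, then the run of `t` extends that of `s`. By symmetry all elements of `T` visit
  -- the same states from `q`.
  have hsub : ∀ q, ∀ s ∈ T, ∀ t ∈ T, (s.toFun q).2 ⊆ (t.toFun q).2 := by
    intro q s hs t ht
    obtain ⟨u, -, rfl⟩ := hT s hs t ht
    exact Finset.subset_union_left
  -- With `s = t u`, the states that `x` visits after `s` are among those that `u x` visits after
  -- `t`, and `u x` visits there the same states as `y`.
  have hle : ∀ s ∈ T, ∀ t ∈ T, ∀ x ∈ T, ∀ y ∈ T,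
      (x.toFun (s.toFun q).1).2 ⊆ (y.toFun (t.toFun q).1).2 := by
    intro s hs t ht x hx y hy
    obtain ⟨u, hu, rfl⟩ := hT t ht s hs
    exact Finset.subset_union_right.trans (hsub _ (u * x) (T.mul_mem hu hx) y hy)
  have hrun : ∀ m : ℕ → Profile Q, (∀ i, m i ∈ T) → ∀ i, ∃ s ∈ T,
      run m q (i + 1) = (s.toFun q).1 := by
    intro m hm i
    induction i with
    | zero => exact ⟨m 0, hm 0, rfl⟩
    | succ i ih =>
      obtain ⟨s, hs, h⟩ := ih
      exact ⟨s * m (i + 1), T.mul_mem hs (hm _), by rw [mul_toFun_fst, ← h]; rfl⟩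
  rcases (T : Set (Profile Q)).eq_empty_or_nonempty with h | ⟨t, ht⟩
  · exact ⟨∅, fun m hm => absurd (hm 0) (Set.eq_empty_iff_forall_notMem.mp h _)⟩
  · refine ⟨(t.toFun (t.toFun q).1).2, fun m hm i hi => ?_⟩
    obtain ⟨j, rfl⟩ := Nat.exists_eq_add_of_le' hi
    obtain ⟨s, hs, h⟩ := hrun m hm j
    rw [h]
    exact (hle s hs t ht _ (hm _) t ht).antisymm (hle t ht s hs t ht _ (hm _))

end Profile

/-! ### Acceptance in terms of profiles -/

namespace ParityAutomaton

variable {d : ℕ} (M : ParityAutomaton d)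

/-- The profile of a letter. -/
def letterProfile (a : Fin d) : Profile (Fin M.states) := ⟨fun q => (M.step q a, {q})⟩

/-- The profile of a finite word. -/
def profile (w : List (Fin d)) : Profile (Fin M.states) := (w.map M.letterProfile).prod

theorem profile_append (v w : List (Fin d)) : M.profile (v ++ w) = M.profile v * M.profile w := by
  simp [profile]

theorem profile_onWord (σ : Substitution (Fin d)) (w : List (Fin d)) :
    M.profile (σ.onWord w) = (w.map fun a => M.profile (σ.image a)).prod := by
  induction w with
  | nil => rfl
  | cons a w ih => rw [onWord_cons, profile_append, ih, List.map_cons, List.prod_cons]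

theorem profile_seg (α : ℕ → Fin d) {i j : ℕ} (h : i ≤ j) :
    (M.profile (seg α i j)).toFun (M.run α i) = (M.run α j, (Finset.Ico i j).image (M.run α)) := by
  induction j, h using Nat.le_induction with
  | base => simp [profile, Profile.one_toFun]
  | succ j h ih =>
    have h1 : M.profile [α j] = M.letterProfile (α j) := by simp [profile]
    rw [seg_succ α h, profile_append, h1]
    refine Prod.ext ?_ ?_
    · rw [Profile.mul_toFun_fst, ih]
      rfl
    · rw [Profile.mul_toFun_snd, ih, ← Finset.insert_Ico_right_eq_Ico_add_one h,
        Finset.image_insert, Finset.insert_eq, Finset.union_comm]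
      rfl

theorem run_profile {α : ℕ → Fin d} {k : ℕ → ℕ} (hk : StrictMono k) (h0 : k 0 = 0) (n : ℕ) :
    Profile.run (fun i => M.profile (seg α (k i) (k (i + 1)))) M.init n = M.run α (k n) := by
  induction n with
  | zero => rw [h0]; rfl
  | succ n ih => rw [Profile.run, ih, profile_seg _ _ (hk (Nat.lt_succ_self n)).le]

/-- The states visited infinitely often. -/
noncomputable def infStates (α : ℕ → Fin d) : Finset (Fin M.states) :=
  open Classical in Finset.univ.filter fun q => ∃ᶠ n in atTop, M.run α n = q

theorem mem_infStates {α : ℕ → Fin d} {q : Fin M.states} :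
    q ∈ M.infStates α ↔ ∃ᶠ n in atTop, M.run α n = q := by
  simp [infStates]

/-- From some position on only states that recur are visited, which gives the upper bound; each of
them is visited infinitely often, which gives the lower bound. -/
theorem limsup_index (α : ℕ → Fin d) :
    limsup (fun n => M.index (M.run α n)) atTop = (M.infStates α).sup M.index := by
  have hbdd : IsBoundedUnder (· ≤ ·) atTop fun n => M.index (M.run α n) :=
    isBoundedUnder_of ⟨Finset.univ.sup M.index, fun n =>
      Finset.le_sup (f := M.index) (Finset.mem_univ (M.run α n))⟩
  apply le_antisymm
  · refine limsup_le_of_le (by isBoundedDefault) ?_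
    have h : ∀ᶠ n in atTop, ∀ q, q ∉ M.infStates α → M.run α n ≠ q := by
      rw [eventually_all]
      intro q
      by_cases hq : q ∈ M.infStates α
      · simp [hq]
      · rw [mem_infStates, not_frequently] at hq
        filter_upwards [hq] with n hn _ using hn
    filter_upwards [h] with n hn
    refine Finset.le_sup ?_
    by_contra hc
    exact hn _ hc rfl
  · refine Finset.sup_le fun q hq => ?_
    rw [mem_infStates] at hq
    exact le_limsup_of_frequently_le (hq.mono fun n hn => by rw [hn]) hbdd

theorem accepts_iff (α : ℕ → Fin d) : M.Accepts α ↔ Even ((M.infStates α).sup M.index) := by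
  rw [Accepts, limsup_index]

/-- Each factor is finite, so a state recurs if and only if infinitely many factors visit it. -/
theorem mem_infStates_iff_of_cuts {α : ℕ → Fin d} {k : ℕ → ℕ} (hk : StrictMono k) (h0 : k 0 = 0)
    {q : Fin M.states} : q ∈ M.infStates α ↔ ∃ᶠ i in atTop, q ∈
      ((M.profile (seg α (k i) (k (i + 1)))).toFun (Profile.run
        (fun i => M.profile (seg α (k i) (k (i + 1)))) M.init i)).2 := by
  have hseg : ∀ i, ((M.profile (seg α (k i) (k (i + 1)))).toFun (Profile.run
        (fun i => M.profile (seg α (k i) (k (i + 1)))) M.init i)).2 =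
      (Finset.Ico (k i) (k (i + 1))).image (M.run α) := by
    intro i
    rw [run_profile M hk h0, profile_seg _ _ (hk (Nat.lt_succ_self i)).le]
  simp only [hseg, mem_infStates, frequently_atTop, Finset.mem_image, Finset.mem_Ico]
  constructor
  · intro h a
    obtain ⟨n, hn, hq⟩ := h (k a)
    obtain ⟨i, hi1, hi2⟩ := hk.exists_le_lt_succ h0 n
    have hai : k a < k (i + 1) := hn.trans_lt hi2
    rw [hk.lt_iff_lt] at hai
    exact ⟨i, by omega, n, ⟨hi1, hi2⟩, hq⟩
  · intro h a
    obtain ⟨i, hi, n, hn, hq⟩ := h a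
    exact ⟨n, le_trans hi (hk.le_apply.trans hn.1), hq⟩

/-- Acceptance depends only on the profiles of the factors into which a word is cut. -/
theorem accepts_congr {α β : ℕ → Fin d} {k l : ℕ → ℕ} (hk : StrictMono k) (hk0 : k 0 = 0)
    (hl : StrictMono l) (hl0 : l 0 = 0)
    (h : ∀ i, M.profile (seg α (k i) (k (i + 1))) = M.profile (seg β (l i) (l (i + 1)))) :
    M.Accepts α ↔ M.Accepts β := by
  have heq : M.infStates α = M.infStates β := by
    ext q
    rw [mem_infStates_iff_of_cuts M hk hk0, mem_infStates_iff_of_cuts M hl hl0]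
    simp only [h]
  rw [accepts_iff, accepts_iff, heq]

/-- All words that can be cut into factors whose profiles belong to a given right simple semigroup
are accepted, or none of them. -/
theorem accepts_iff_of_mem {T : Subsemigroup (Profile (Fin M.states))}
    (hT : ∀ s ∈ T, ∀ t ∈ T, ∃ u ∈ T, t = s * u) {α β : ℕ → Fin d} {k l : ℕ → ℕ}
    (hk : StrictMono k) (hk0 : k 0 = 0) (hl : StrictMono l) (hl0 : l 0 = 0)
    (hα : ∀ i, M.profile (seg α (k i) (k (i + 1))) ∈ T)
    (hβ : ∀ i, M.profile (seg β (l i) (l (i + 1))) ∈ T) : M.Accepts α ↔ M.Accepts β := by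
  obtain ⟨I, hI⟩ := Profile.exists_visited_eq hT M.init
  have key : ∀ {γ : ℕ → Fin d} {c : ℕ → ℕ}, StrictMono c → c 0 = 0 →
      (∀ i, M.profile (seg γ (c i) (c (i + 1))) ∈ T) → M.infStates γ = I := by
    intro γ c hc hc0 hγ
    ext q
    rw [mem_infStates_iff_of_cuts M hc hc0]
    have hev : ∀ᶠ i in atTop, (q ∈ ((M.profile (seg γ (c i) (c (i + 1)))).toFun (Profile.run
        (fun i => M.profile (seg γ (c i) (c (i + 1)))) M.init i)).2 ↔ q ∈ I) := by
      filter_upwards [eventually_ge_atTop 1] with i hi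
      rw [hI _ hγ i hi]
    rw [frequently_congr hev]
    simp
  rw [accepts_iff, accepts_iff, key hk hk0 hα, key hl hl0 hβ]

/-- Both images are cut at the images of the letters of `α`; the cuts lie at different places, but
corresponding factors have the same profile. -/
theorem accepts_onInfWord_congr {ρ σ : Substitution (Fin d)}
    (h : ∀ a, M.profile (ρ.image a) = M.profile (σ.image a)) (α : ℕ → Fin d) :
    M.Accepts (ρ.onInfWord α) ↔ M.Accepts (σ.onInfWord α) := by
  refine accepts_congr M (ρ.cut_strictMono α) (ρ.cut_zero α) (σ.cut_strictMono α) (σ.cut_zero α) ?_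
  intro i
  rw [seg_cut _ _ (Nat.le_succ i), seg_cut _ _ (Nat.le_succ i)]
  simp [h]

theorem profile_comp_pow {ρ κ : Substitution (Fin d)}
    (h : ∀ a, M.profile ((ρ.comp κ).image a) = M.profile (ρ.image a)) (n : ℕ) (w : List (Fin d)) :
    M.profile (ρ.onWord ((κ.pow n).onWord w)) = M.profile (ρ.onWord w) := by
  induction n generalizing w with
  | zero => simp [pow_zero]
  | succ n ih =>
    rw [pow_succ, comp_onWord, ih, ← comp_onWord, profile_onWord, profile_onWord]
    simp only [h]

end ParityAutomaton

theorem exists_cuts {A : Type*} {x : ℕ → A} {b : A} (h0 : x 0 = b) {m : ℕ}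
    (h : ∀ i, ∃ j, i < j ∧ j ≤ i + m ∧ x j = b) :
    ∃ k : ℕ → ℕ, StrictMono k ∧ k 0 = 0 ∧ (∀ i, k (i + 1) ≤ k i + m) ∧ ∀ i, x (k i) = b := by
  choose f hf1 hf2 hf3 using h
  refine ⟨fun n => f^[n] 0, strictMono_nat_of_lt_succ fun n => ?_, rfl, fun n => ?_, fun n => ?_⟩
  · simp only [Function.iterate_succ_apply']
    exact hf1 _
  · simp only [Function.iterate_succ_apply']
    exact hf2 _
  · cases n with
    | zero => exact h0
    | succ n =>
      simp only [Function.iterate_succ_apply']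
      exact hf3 _

/-! ### Factors between occurrences of a letter -/

namespace ParityAutomaton

variable {d : ℕ} (M : ParityAutomaton d)

/-- The profiles of the images under `ρ` of the factors of `ω` between two occurrences of `b`. -/
def returnProfiles (ρ : Substitution (Fin d)) (ω : ℕ → Fin d) (b : Fin d) :
    Set (Profile (Fin M.states)) :=
  {P | ∃ p q, p < q ∧ ω p = b ∧ ω q = b ∧ P = M.profile (ρ.onWord (seg ω p q))}

/-- The factor of `ω` between the occurrences `p < q` of `b` may be replaced by its image under a
power `K` of `κ`, which does not change the profile after `ρ` is applied. This image begins with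
`K(b)`, a prefix of `ω` that reaches beyond any prescribed factor from `p'` to `q'`. So it splits
into the factor from `0` to `p'`, that from `p'` to `q'`, and a rest that again lies between two
occurrences of `b`. This is the common initial part `y x` required by
`Subsemigroup.exists_eq_mul_of_mem_closure`. -/
theorem rightSimple_closure_returnProfiles [Nontrivial (Fin d)] {ρ κ : Substitution (Fin d)}
    (hκ : κ.Positive) (hprof : ∀ a, M.profile ((ρ.comp κ).image a) = M.profile (ρ.image a))
    {ω : ℕ → Fin d} (hω : κ.onInfWord ω = ω) {b : Fin d} (hω0 : ω 0 = b) :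
    ∀ s ∈ Subsemigroup.closure (M.returnProfiles ρ ω b),
      ∀ t ∈ Subsemigroup.closure (M.returnProfiles ρ ω b),
        ∃ u ∈ Subsemigroup.closure (M.returnProfiles ρ ω b), t = s * u := by
  apply Subsemigroup.exists_eq_mul_of_mem_closure
  rintro x ⟨p', q', hpq', hp', hq', rfl⟩
  refine ⟨M.profile (ρ.onWord (seg ω 0 p')), ?_, ?_⟩
  · rcases Nat.eq_zero_or_pos p' with rfl | hpos
    · left
      simp [profile]
    · exact Or.inr ⟨0, p', hpos, hω0, hp', rfl⟩
  rintro e ⟨p, q, hpq, hp, hq, rfl⟩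
  set K := κ.pow (q' + 1) with hK
  have hKω : K.onInfWord ω = ω := pow_onInfWord_of_fixed hω _
  have hlen : q' + 1 < (K.image b).length := hκ.lt_length_pow _ b
  have hpre : seg ω 0 (K.image b).length = K.image b := by
    have := ((isPrefixOf_singleton (α := ω)).mpr hω0).onWord K
    rwa [hKω, onWord_singleton] at this
  have hocc : ∀ i, ω i = b → seg ω (K.cut ω i) (K.cut ω i + (K.image b).length) =
      seg ω 0 (0 + (K.image b).length) := by
    intro i hi
    have h1 := K.seg_cut ω (Nat.le_succ i)
    have h2 := K.cut_add ω (Nat.le_succ i)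
    simp only [Nat.succ_eq_add_one, seg_succ_self, onWord_singleton, hi, hKω] at h1 h2
    rw [← h2, h1, Nat.zero_add, hpre]
  have hP := seg_eq_seg_iff.mp (hocc p hp)
  have hQ := seg_eq_seg_iff.mp (hocc q hq)
  simp only [Nat.zero_add] at hP hQ
  have hPQ : K.cut ω p + (K.image b).length ≤ K.cut ω q := by
    have h1 := K.cut_add ω (Nat.le_succ p)
    have h2 := (K.cut_strictMono ω).monotone (Nat.succ_le_of_lt hpq)
    simp only [Nat.succ_eq_add_one, seg_succ_self, onWord_singleton, hp] at h1 h2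
    omega
  refine ⟨M.profile (ρ.onWord (seg ω (K.cut ω p + q') (K.cut ω q))),
    ⟨_, _, by omega, ?_, ?_, rfl⟩, ?_⟩
  · rw [hP q' (by omega), hq']
  · have := hQ 0 (by omega)
    rw [Nat.add_zero] at this
    rw [this, hω0]
  · have h1 : seg ω 0 p' = seg ω (K.cut ω p) (K.cut ω p + p') := by
      have := seg_eq_seg_iff (α := ω) (β := ω) (i := K.cut ω p) (j := 0) (n := p')
      rw [Nat.zero_add] at this
      refine (this.mpr fun r hr => ?_).symm
      rw [hP r (by omega), Nat.zero_add]
    have h2 : seg ω p' q' = seg ω (K.cut ω p + p') (K.cut ω p + q') := by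
      obtain ⟨n, rfl⟩ := Nat.exists_eq_add_of_le hpq'.le
      rw [← Nat.add_assoc, eq_comm, seg_eq_seg_iff]
      intro r hr
      rw [Nat.add_assoc, hP _ (by omega)]
    rw [h1, h2, ← profile_append, ← profile_append, ← onWord_append, ← onWord_append,
      seg_append ω (by omega) (by omega), seg_append ω (by omega) (by omega),
      ← M.profile_comp_pow hprof (q' + 1), ← hK, ← K.seg_cut ω hpq.le, hKω]

/-- If `ω` is a fixed point of `κ`, if `ρ` and `ρ κ` have the same effect on the automaton, and if
the factors of `κⁿ(β)` of any given length are factors of `ω` for some `n`, then the automaton does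
not distinguish between `ρ(β)` and `ρ(ω)`. -/
theorem accepts_iff_fixed [Nontrivial (Fin d)] {ρ κ : Substitution (Fin d)}
    (hκ : κ.Positive) (hprof : ∀ a, M.profile ((ρ.comp κ).image a) = M.profile (ρ.image a))
    {ω β : ℕ → Fin d} (hω : κ.onInfWord ω = ω) {b : Fin d} (hb : (κ.image b).head? = some b)
    (hω0 : ω 0 = b) (hβ0 : β 0 = b)
    (hfac : ∀ m, ∃ n, ∀ i, ∃ j, ∀ r < m, (κ.pow (n + 1)).onInfWord β (i + r) = ω (j + r)) :
    M.Accepts (ρ.onInfWord β) ↔ M.Accepts (ρ.onInfWord ω) := by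
  obtain ⟨m, hm⟩ := hκ.exists_gap b
  -- Length `m + 1` covers a gap of at most `m` together with the occurrences of `b` at both its
  -- ends.
  obtain ⟨n, hn⟩ := hfac (m + 1)
  set x := (κ.pow (n + 1)).onInfWord β with hx
  have hx0 : x 0 = b := onInfWord_apply_zero (by rw [hβ0]; exact head?_pow hb _)
  have hxgap : ∀ i, ∃ j, i < j ∧ j ≤ i + m ∧ x j = b := by
    have := hm ((κ.pow n).onInfWord β)
    rwa [← comp_onInfWord, ← pow_succ'] at this
  have hωgap : ∀ i, ∃ j, i < j ∧ j ≤ i + m ∧ ω j = b := by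
    have := hm ω
    rwa [hω] at this
  obtain ⟨k, hk, hk0, hkm, hkb⟩ := exists_cuts hx0 hxgap
  obtain ⟨l, hl, hl0, -, hlb⟩ := exists_cuts hω0 hωgap
  have h1 : M.Accepts (ρ.onInfWord β) ↔ M.Accepts (ρ.onInfWord x) := by
    rw [hx, ← comp_onInfWord]
    refine M.accepts_onInfWord_congr (fun a => ?_) β
    have := M.profile_comp_pow hprof (n + 1) [a]
    rw [onWord_singleton, onWord_singleton] at this
    exact this.symm
  rw [h1]
  refine M.accepts_iff_of_mem (M.rightSimple_closure_returnProfiles hκ hprof hω hω0)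
    (k := ρ.cut x ∘ k) (l := ρ.cut ω ∘ l) ((ρ.cut_strictMono x).comp hk) (by simp [hk0])
    ((ρ.cut_strictMono ω).comp hl) (by simp [hl0]) (fun i => Subsemigroup.subset_closure ?_)
    (fun i => Subsemigroup.subset_closure ?_)
  · have hlt := hk (Nat.lt_succ_self i)
    have hle := hkm i
    obtain ⟨j, hj⟩ := hn (k i)
    obtain ⟨t, ht⟩ := Nat.exists_eq_add_of_le hlt.le
    simp only [Nat.succ_eq_add_one] at hlt ht
    refine ⟨j, j + t, by omega, ?_, ?_, ?_⟩
    · have := hj 0 (by omega)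
      rw [Nat.add_zero, Nat.add_zero] at this
      rw [← this, hkb]
    · rw [← hj t (by omega), ← ht, hkb]
    · simp only [Function.comp_apply]
      rw [seg_cut _ _ hlt.le, ht, seg_eq_seg_iff.mpr fun r hr => hj r (by omega)]
  · have hlt := hl (Nat.lt_succ_self i)
    refine ⟨l i, l (i + 1), hlt, hlb _, hlb _, ?_⟩
    simp only [Function.comp_apply]
    rw [seg_cut _ _ hlt.le]

end ParityAutomaton

/-! ### Values in an ω-semigroup -/

section Values

variable {A F : Type*} [Semigroup F]

theorem wordValue_nil (h : A → F) : wordValue h [] = 1 := rfl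

theorem wordValue_cons (h : A → F) (a : A) (w : List A) :
    wordValue h (a :: w) = h a * wordValue h w := by
  simp [wordValue]

theorem wordValue_append (h : A → F) (v w : List A) :
    wordValue h (v ++ w) = wordValue h v * wordValue h w := by
  simp [wordValue]

theorem exists_coe_eq_wordValue (h : A → F) {w : List A} (hw : w ≠ []) :
    ∃ x : F, (x : WithOne F) = wordValue h w := by
  cases w with
  | nil => exact absurd rfl hw
  | cons a w =>
    rw [wordValue_cons]
    rcases eq_or_ne w [] with rfl | hw
    · exact ⟨h a, by simp [wordValue_nil]⟩
    · cases hx : wordValue h w with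
      | one => exact ⟨h a, by simp⟩
      | coe x => exact ⟨h a * x, by simp⟩

/-- The values of the images of the letters under a substitution. -/
noncomputable def valueMap (h : A → F) (σ : Substitution A) (a : A) : F :=
  (exists_coe_eq_wordValue h (σ.image_ne_nil a)).choose

theorem coe_valueMap (h : A → F) (σ : Substitution A) (a : A) :
    ((valueMap h σ a : F) : WithOne F) = wordValue h (σ.image a) :=
  (exists_coe_eq_wordValue h (σ.image_ne_nil a)).choose_spec

theorem wordValue_onWord (h : A → F) (σ : Substitution A) (w : List A) :
    wordValue h (σ.onWord w) = wordValue (valueMap h σ) w := by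
  induction w with
  | nil => rfl
  | cons a w ih => rw [onWord_cons, wordValue_append, wordValue_cons, coe_valueMap, ih]

/-- The images of each letter under `σ` and `μ` begin with the same letter, and their remaining
parts have the same value for each morphism into `F`. -/
def TailEquiv (F : Type*) [Semigroup F] (σ μ : Substitution A) : Prop :=
  ∀ (a : A) (h : A → F), ∃ c v w, σ.image a = c :: v ∧ μ.image a = c :: w ∧
    wordValue h v = wordValue h w

theorem TailEquiv.refl (σ : Substitution A) : TailEquiv F σ σ := by
  intro a h
  obtain ⟨c, v, hv⟩ := List.exists_cons_of_ne_nil (σ.image_ne_nil a)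
  exact ⟨c, v, v, hv, hv, rfl⟩

theorem TailEquiv.valueMap_eq {σ μ : Substitution A} (hσμ : TailEquiv F σ μ) (h : A → F) :
    valueMap h σ = valueMap h μ := by
  funext a
  obtain ⟨c, v, w, hv, hw, hvw⟩ := hσμ a h
  apply WithOne.coe_injective
  rw [coe_valueMap, coe_valueMap, hv, hw, wordValue_cons, wordValue_cons, hvw]

/-- The tail of `σ(μ(a))` is the tail of `σ(c)` followed by the image of the tail of `μ(a)`. The
value of the latter is a value under the morphism `valueMap h σ`, so it matters that the relation
quantifies over all morphisms. -/
theorem TailEquiv.comp {σ σ' μ μ' : Substitution A} (hσ : TailEquiv F σ σ')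
    (hμ : TailEquiv F μ μ') : TailEquiv F (σ.comp μ) (σ'.comp μ') := by
  intro a h
  obtain ⟨c, v, w, hv, hw, hvw⟩ := hμ a (valueMap h σ)
  obtain ⟨e, x, y, hx, hy, hxy⟩ := hσ c h
  refine ⟨e, x ++ σ.onWord v, y ++ σ'.onWord w, ?_, ?_, ?_⟩
  · rw [comp_image, hv, onWord_cons, hx, List.cons_append]
  · rw [comp_image, hw, onWord_cons, hy, List.cons_append]
  · rw [wordValue_append, wordValue_append, hxy, wordValue_onWord, wordValue_onWord, hvw,
      hσ.valueMap_eq]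

theorem TailEquiv.block {s t : ℕ → Substitution A} {i n : ℕ}
    (h : ∀ r < n, TailEquiv F (s (i + r)) (t (i + r))) :
    TailEquiv F (block s i n) (block t i n) := by
  induction n with
  | zero => exact TailEquiv.refl _
  | succ n ih => exact (ih fun r hr => h r (by omega)).comp (h n (by omega))

theorem TailEquiv.pow {κ κ' : Substitution A} (h : TailEquiv F κ κ') (n : ℕ) :
    TailEquiv F (κ.pow n) (κ'.pow n) :=
  TailEquiv.block fun _ _ => h

theorem wordValue_splitAux [DecidableEq A] (h : A → F) (seen w : List A) :
    wordValue h w = wordValue h (splitAux seen w).1 *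
      ((splitAux seen w).2.map fun x => (h x.1 : WithOne F) * wordValue h x.2).prod := by
  induction w generalizing seen with
  | nil => simp [splitAux, wordValue_nil]
  | cons c w ih =>
    rw [splitAux, wordValue_cons]
    split_ifs with hc
    · rw [ih seen, wordValue_cons, mul_assoc]
    · rw [ih (c :: seen), wordValue_nil, one_mul, List.map_cons, List.prod_cons, mul_assoc]

/-- The letters and values in the factorisation determine the value of everything after the first
letter. Only this coarser information is needed, and it is evidently stable under composition. -/
theorem SegmentEquiv.tailEquiv [DecidableEq A] {σ μ : Substitution A} (hσμ : SegmentEquiv F σ μ) :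
    TailEquiv F σ μ := by
  intro a h
  obtain ⟨c, v, hv⟩ := List.exists_cons_of_ne_nil (σ.image_ne_nil a)
  obtain ⟨e, w, hw⟩ := List.exists_cons_of_ne_nil (μ.image_ne_nil a)
  have heq := hσμ a h
  simp only [segments, firstOccurrences, hv, hw, splitAux, List.not_mem_nil, if_false,
    List.map_cons, List.cons.injEq, Prod.mk.injEq] at heq
  obtain ⟨⟨rfl, h1⟩, h2⟩ := heq
  refine ⟨c, v, w, hv, hw, ?_⟩
  have hmap : ∀ l : List (A × List A), (l.map fun x => (h x.1 : WithOne F) * wordValue h x.2) =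
      (l.map fun x => (x.1, wordValue h x.2)).map fun x => (h x.1 : WithOne F) * x.2 := by
    intro l
    rw [List.map_map]
    rfl
  rw [wordValue_splitAux h [c] v, wordValue_splitAux h [c] w, h1, hmap, hmap, h2]

theorem coe_segmentProd (h : A → F) (α : ℕ → A) (i n : ℕ) :
    ((segmentProd (fun r => h (α r)) i n : F) : WithOne F) = wordValue h (seg α i (i + n + 1)) := by
  induction n with
  | zero => simp [segmentProd, wordValue_cons, wordValue_nil]
  | succ n ih =>
    rw [segmentProd, WithOne.coe_mul, ih, ← Nat.add_assoc, seg_succ α (j := i + n + 1) (by omega),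
      wordValue_append, wordValue_cons, wordValue_nil, mul_one, Nat.add_assoc i n 1]

/-- The infinite product of a word that is cut at the positions `K 0 < K 1 < ⋯`. -/
theorem iprod_eq_of_cuts {O : Type*} [OmegaSemigroup F O] (h : A → F) {α : ℕ → A} {K : ℕ → ℕ}
    (hK : StrictMono K) (h0 : 0 < K 0) {f : ℕ → F}
    (hf0 : (f 0 : WithOne F) = wordValue h (seg α 0 (K 0)))
    (hf : ∀ n, (f (n + 1) : WithOne F) = wordValue h (seg α (K n) (K (n + 1)))) :
    (OmegaSemigroup.iprod fun n => h (α n) : O) = OmegaSemigroup.iprod f := by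
  have hpos : ∀ n, 0 < K n := fun n => h0.trans_le (hK.monotone (Nat.zero_le n))
  have hlt : ∀ n, K n < K (n + 1) := fun n => hK (Nat.lt_succ_self n)
  -- The law for grouping names the last index of each group, the cuts `K n` name the first index of
  -- the next one.
  rw [OmegaSemigroup.iprod_group (O := O) (fun n => h (α n)) (fun n => K n - 1)
    (strictMono_nat_of_lt_succ fun n => by
      have := hpos n
      have := hlt n
      omega)]
  congr 1
  funext n
  apply WithOne.coe_injective
  cases n with
  | zero =>
    change ((segmentProd _ 0 (K 0 - 1) : F) : WithOne F) = _
    rw [coe_segmentProd, hf0, Nat.zero_add, Nat.sub_add_cancel h0]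
  | succ n =>
    change ((segmentProd _ (K n - 1 + 1) (K (n + 1) - 1 - (K n - 1 + 1)) : F) : WithOne F) = _
    have h1 := hpos n
    have h2 := hlt n
    rw [coe_segmentProd, hf, Nat.sub_add_cancel h1]
    congr 2
    omega

/-- Equivalent substitutions `ρ ≡ ρ'` and `κ ≡ κ'` give words `ρ(κ^ω(b))` and `ρ'(κ'^ω(b))` with
the same value. -/
theorem iprod_fixed_eq [Nontrivial A] {O : Type*} [OmegaSemigroup F O] (h : A → F)
    {ρ ρ' κ κ' : Substitution A} (hρ : TailEquiv F ρ ρ') (hκ : TailEquiv F κ κ')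
    (hpos : κ.Positive) (hpos' : κ'.Positive) {b : A} (hb : (κ.image b).head? = some b)
    {ω ω' : ℕ → A} (hω : κ.onInfWord ω = ω) (hω' : κ'.onInfWord ω' = ω') (h0 : ω 0 = b)
    (h0' : ω' 0 = b) :
    (OmegaSemigroup.iprod fun n => h (ρ.onInfWord ω n) : O) =
      OmegaSemigroup.iprod fun n => h (ρ'.onInfWord ω' n) := by
  obtain ⟨c, v, v', hv, hv', -⟩ := hκ b h
  obtain rfl : c = b := by simpa [hv] using hb
  have hne : ∀ {μ : Substitution A} {u : List A}, μ.Positive → μ.image c = c :: u → u ≠ [] := by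
    intro μ u hμ hu
    have := hμ.two_le_length c
    rw [hu, List.length_cons] at this
    exact List.length_pos_iff.mp (by omega)
  -- If `μ(c) = c u`, then `σ(μ^ω(c))` is cut into `σ(c)`, `σ(u)`, `σμ(u)`, `σμ²(u)`, and so on; `f`
  -- lists the values of these factors.
  have key : ∀ {σ μ : Substitution A} {u : List A} {ζ : ℕ → A}, μ.Positive → μ.image c = c :: u →
      μ.onInfWord ζ = ζ → ζ 0 = c → ∀ f : ℕ → F,
      (f 0 : WithOne F) = wordValue h (σ.image c) →
      (∀ n, (f (n + 1) : WithOne F) = wordValue h ((σ.comp (μ.pow n)).onWord u)) →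
      (OmegaSemigroup.iprod fun n => h (σ.onInfWord ζ n) : O) = OmegaSemigroup.iprod f := by
    intro σ μ u ζ hμ hu hζ hζ0 f hf0 hf
    set K : ℕ → ℕ := fun n => ((σ.comp (μ.pow n)).image c).length with hK
    have hpre : ∀ n, seg (σ.onInfWord ζ) 0 (K n) = (σ.comp (μ.pow n)).image c := by
      intro n
      have := ((isPrefixOf_singleton (α := ζ)).mpr hζ0).onWord (σ.comp (μ.pow n))
      rwa [onWord_singleton, comp_onInfWord, pow_onInfWord_of_fixed hζ] at this
    have hstep : ∀ n, (σ.comp (μ.pow (n + 1))).image c =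
        (σ.comp (μ.pow n)).image c ++ (σ.comp (μ.pow n)).onWord u := by
      intro n
      rw [pow_succ, ← comp_assoc, comp_image, hu, onWord_cons]
    have hlt : ∀ n, K n < K (n + 1) := by
      intro n
      have := List.length_pos_iff.mpr (onWord_ne_nil (σ.comp (μ.pow n)) (hne hμ hu))
      simp only [hK, hstep, List.length_append]
      omega
    refine iprod_eq_of_cuts h (strictMono_nat_of_lt_succ hlt) (length_image_pos _ _) ?_ ?_
    · rw [hpre, hf0, pow_zero, comp_id]
    · intro n
      rw [hf]
      congr 1
      have h1 := hpre (n + 1)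
      rw [← seg_append _ (Nat.zero_le _) (hlt n).le, hpre n, hstep] at h1
      exact (List.append_cancel_left h1).symm
  choose g hg using fun n => exists_coe_eq_wordValue h
    (onWord_ne_nil (ρ.comp (κ.pow n)) (hne hpos hv))
  let f : ℕ → F := fun n => Nat.casesOn n (valueMap h ρ c) g
  rw [key hpos hv hω h0 f (coe_valueMap h ρ c) hg]
  refine (key hpos' hv' hω' h0' f ?_ fun n => ?_).symm
  · rw [← coe_valueMap, ← hρ.valueMap_eq]
    rfl
  · have hcomp := hρ.comp (hκ.pow n)
    obtain ⟨e, x, y, hx, hy, hxy⟩ := hκ c (valueMap h (ρ.comp (κ.pow n)))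
    rw [hv, List.cons.injEq] at hx
    rw [hv', List.cons.injEq] at hy
    obtain ⟨-, rfl⟩ := hx
    obtain ⟨-, rfl⟩ := hy
    rw [wordValue_onWord, ← hcomp.valueMap_eq, ← hxy, ← wordValue_onWord, ← hg n]

end Values

/-! ### Words at the levels of a directive sequence -/

namespace Substitution

variable {A : Type*}

/-- `σ_n(c_{n+1})` begins with `c_n`. -/
def IsChain (s : ℕ → Substitution A) (c : ℕ → A) : Prop :=
  ∀ n, ((s n).image (c (n + 1))).head? = some (c n)

theorem IsChain.head?_block {s : ℕ → Substitution A} {c : ℕ → A} (h : IsChain s c) (n m : ℕ) :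
    ((block s n m).image (c (n + m))).head? = some (c n) := by
  induction m with
  | zero => simp [block_zero, id]
  | succ m ih => exact head?_onWord (h (n + m)) ih

/-- A weakly primitive sequence with a compatible sequence of letters generates infinite words at
all levels. -/
theorem IsChain.exists_levels [Nontrivial A] {s : ℕ → Substitution A} {c : ℕ → A}
    (h : IsChain s c) (hs : WeaklyPrimitive s) :
    ∃ γ : ℕ → ℕ → A, (∀ n, (s n).onInfWord (γ (n + 1)) = γ n) ∧ (∀ n, γ n 0 = c n) ∧
      ∀ n m, IsPrefixOf ((block s n m).image (c (n + m))) (γ n) := by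
  have hlen : ∀ n L, ∃ m, L ≤ ((block s n m).image (c (n + m))).length := by
    intro n L
    obtain ⟨m, hm⟩ := hs.exists_length n L
    exact ⟨m, hm m le_rfl _⟩
  choose γ hγ using fun n => exists_isPrefixOf
    (w := fun m => (block s n m).image (c (n + m)))
    (fun m => by
      rw [block_succ, comp_image]
      exact prefix_onWord (h (n + m))) (hlen n)
  refine ⟨γ, fun n => ?_, fun n => (hγ n 0).apply_zero rfl, hγ⟩
  refine eq_of_isPrefixOf fun L => ?_
  obtain ⟨m, hm⟩ := hlen (n + 1) L
  refine ⟨(block s n (m + 1)).image (c (n + (m + 1))), ?_, ?_, hγ _ _⟩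
  · rw [block_succ', comp_image, show n + (m + 1) = n + 1 + m by omega]
    exact hm.trans (length_le_onWord _ _)
  · rw [block_succ', comp_image, show n + (m + 1) = n + 1 + m by omega]
    exact (hγ (n + 1) m).onWord (s n)

theorem block_onInfWord_levels {s : ℕ → Substitution A} {γ : ℕ → ℕ → A}
    (h : ∀ n, (s n).onInfWord (γ (n + 1)) = γ n) (n m : ℕ) :
    (block s n m).onInfWord (γ (n + m)) = γ n := by
  induction m with
  | zero => simp [block_zero]
  | succ m ih => rw [block_succ, comp_onInfWord, ← Nat.add_assoc, h, ih]

/-! ### Words directed by weakly primitive sequences -/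

/-- The set of the infinite words directed by a weakly primitive sequence over `S`. -/
def directedWords (S : Set (Substitution A)) : Set (ℕ → A) :=
  {α | ∃ s : ℕ → Substitution A, (∀ n, s n ∈ S) ∧ WeaklyPrimitive s ∧ Directs s α}

theorem levels_mem_directedWords {S : Set (Substitution A)} {s : ℕ → Substitution A}
    {γ : ℕ → ℕ → A} (hS : ∀ n, s n ∈ S) (hs : WeaklyPrimitive s)
    (h : ∀ n, (s n).onInfWord (γ (n + 1)) = γ n) (k : ℕ) : γ k ∈ directedWords S :=
  ⟨fun n => s (k + n), fun _ => hS _, hs.shift k, fun n => γ (k + n), rfl, fun _ => h _⟩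

/-- The word is directed by `σ` followed by a sequence for `α`. Covering is exactly what keeps an
initial positive block positive when `σ` is put in front of it. -/
theorem onInfWord_mem_directedWords {S : Set (Substitution A)} {σ : Substitution A} (hσS : σ ∈ S)
    (hσ : σ.Covering) {α : ℕ → A} (hα : α ∈ directedWords S) :
    σ.onInfWord α ∈ directedWords S := by
  obtain ⟨s, hS, hs, β, hβ0, hβ⟩ := hα
  refine ⟨fun n => Nat.casesOn n σ s, fun n => ?_, fun n => ?_,
    fun n => Nat.casesOn n (σ.onInfWord α) β, rfl, fun n => ?_⟩
  · cases n with
    | zero => exact hσS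
    | succ n => exact hS n
  · have hshift : ∀ n m, block (fun n => Nat.casesOn n σ s) (n + 1) m = block s n m := by
      intro n m
      refine block_congr fun r _ => ?_
      rw [show n + 1 + r = n + r + 1 by omega]
    cases n with
    | zero =>
      obtain ⟨m, -, hm⟩ := hs 0
      refine ⟨m + 1, Nat.zero_le _, ?_⟩
      rw [block_succ', Nat.sub_zero, hshift]
      exact hσ.comp_positive hm
    | succ n =>
      obtain ⟨m, hnm, hm⟩ := hs n
      refine ⟨m + 1, by omega, ?_⟩
      rwa [hshift, Nat.add_sub_add_right]
  · cases n with
    | zero => exact congrArg _ hβ0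
    | succ n => exact hβ n

theorem block_onInfWord_mem_directedWords {S : Set (Substitution A)} {s : ℕ → Substitution A}
    (hS : ∀ n, s n ∈ S) (hs : ∀ n, (s n).Covering) {α : ℕ → A} (hα : α ∈ directedWords S)
    (i n : ℕ) : (block s i n).onInfWord α ∈ directedWords S := by
  induction n generalizing α with
  | zero => simpa [block_zero] using hα
  | succ n ih =>
    rw [block_succ, comp_onInfWord]
    exact ih (onInfWord_mem_directedWords (hS _) (hs _) hα)

theorem pow_onInfWord_mem {W : Set (ℕ → A)} {κ : Substitution A}
    (h : ∀ α ∈ W, κ.onInfWord α ∈ W) {α : ℕ → A} (hα : α ∈ W) (n : ℕ) :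
    (κ.pow n).onInfWord α ∈ W := by
  induction n generalizing α with
  | zero => simpa [pow_zero] using hα
  | succ n ih =>
    rw [pow_succ, comp_onInfWord]
    exact ih (h α hα)

/-- A fixed point of a block of `s` is directed by the periodic repetition of this block. -/
theorem fixed_mem_directedWords {S : Set (Substitution A)} {s : ℕ → Substitution A}
    (hS : ∀ n, s n ∈ S) (hs : ∀ n, (s n).Covering) {K l : ℕ} (hl : 0 < l)
    (hpos : (block s K l).Positive) {ω : ℕ → A} (hω : (block s K l).onInfWord ω = ω) :
    ω ∈ directedWords S := by
  have hmod : ∀ n r, n % l + r < l → (n + r) % l = n % l + r := by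
    intro n r h
    rw [Nat.add_mod, Nat.mod_eq_of_lt (show r < l by omega), Nat.mod_eq_of_lt h]
  -- At level `n` the word is obtained from `ω` by applying the part of the period that is still to
  -- come.
  refine ⟨fun n => s (K + n % l), fun _ => hS _, fun n => ?_,
    fun n => (block s (K + n % l) (l - n % l)).onInfWord ω, ?_, fun n => ?_⟩
  · have hlt := Nat.mod_lt n hl
    have h1 : block (fun n => s (K + n % l)) n (l - n % l) = block s (K + n % l) (l - n % l) := by
      refine block_congr fun r hr => ?_
      rw [hmod n r (by omega), Nat.add_assoc]
    have h0 : (n + (l - n % l)) % l = 0 := by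
      rw [← Nat.mod_add_mod, show n % l + (l - n % l) = l by omega, Nat.mod_self]
    have h2 : block (fun n => s (K + n % l)) (n + (l - n % l)) l = block s K l := by
      refine block_congr fun r hr => ?_
      rw [hmod _ r (by omega), h0, Nat.zero_add]
    -- The block consists of the rest of the current period and one full period, which is positive.
    refine ⟨n + (l - n % l) + l - 1, by omega, ?_⟩
    rw [show n + (l - n % l) + l - 1 - n + 1 = (l - n % l) + l by omega, block_add, h1, h2]
    exact (Covering.block fun r _ => hs _).comp_positive hpos
  · simpa using hω
  · have hlt := Nat.mod_lt n hl
    by_cases h : n % l + 1 < l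
    · simp only
      rw [hmod n 1 h, ← comp_onInfWord, ← Nat.add_assoc, ← block_succ',
        show l - (n % l + 1) + 1 = l - n % l by omega]
    · have h0 : (n + 1) % l = 0 := by
        rw [← Nat.mod_add_mod, show n % l + 1 = l by omega, Nat.mod_self]
      simp only
      rw [h0, Nat.add_zero, Nat.sub_zero, hω, show l - n % l = 1 by omega, block_one]

/-- The factors of a given length of an infinite word over a finite alphabet occur in a common
prefix. -/
theorem exists_prefix_factors [Finite A] (ω : ℕ → A) (m : ℕ) :
    ∃ L, ∀ j, ∃ i, i + m ≤ L ∧ ∀ r < m, ω (j + r) = ω (i + r) := by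
  have hfin : (Set.range fun (i : ℕ) (r : Fin m) => ω (i + r)).Finite := Set.toFinite _
  obtain ⟨P, hP⟩ : ∃ P, ∀ y ∈ Set.range fun (i : ℕ) (r : Fin m) => ω (i + r),
      ∃ i ≤ P, (fun r : Fin m => ω (i + r)) = y := by
    have h : ∀ y : Set.range fun (i : ℕ) (r : Fin m) => ω (i + r),
        ∃ i, (fun r : Fin m => ω (i + r)) = y := fun y => y.2
    choose f hf using h
    have := hfin.to_subtype
    obtain ⟨P, hP⟩ := (Set.finite_range f).bddAbove
    exact ⟨P, fun y hy => ⟨f ⟨y, hy⟩, hP ⟨_, rfl⟩, hf ⟨y, hy⟩⟩⟩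
  refine ⟨P + m, fun j => ?_⟩
  obtain ⟨i, hi, h⟩ := hP _ ⟨j, rfl⟩
  exact ⟨i, by omega, fun r hr => (congrFun h ⟨r, hr⟩).symm⟩

/-- If the words `κⁿ(β)` have the same complexity as the fixed point `ω`, then they have the same
factors of any given length for large `n`. -/
theorem exists_factors_subset [Nontrivial A] [Finite A] {κ : Substitution A} (hκ : κ.Positive)
    {ω β : ℕ → A} (hω : κ.onInfWord ω = ω) (h0 : ω 0 = β 0)
    (hcompl : ∀ n m, factorComplexity ((κ.pow n).onInfWord β) m = factorComplexity ω m) (m : ℕ) :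
    ∃ n, ∀ i, ∃ j, ∀ r < m, (κ.pow (n + 1)).onInfWord β (i + r) = ω (j + r) := by
  obtain ⟨L, hL⟩ := exists_prefix_factors ω m
  refine ⟨L, fun i => ?_⟩
  set x := (κ.pow (L + 1)).onInfWord β with hx
  -- Both words begin with the image of the same letter under `κ^(L+1)`, which is longer than `L`.
  have hagree : ∀ r < L, ω r = x r := by
    have h1 := ((isPrefixOf_singleton (α := ω)).mpr h0).onWord (κ.pow (L + 1))
    have h2 := ((isPrefixOf_singleton (α := β)).mpr rfl).onWord (κ.pow (L + 1))
    rw [pow_onInfWord_of_fixed hω] at h1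
    rw [← hx] at h2
    have hlen := hκ.lt_length_pow (L + 1) (β 0)
    rw [onWord_singleton, isPrefixOf_iff] at h1 h2
    intro r hr
    exact Option.some_injective _ ((h1 r (by omega)).symm.trans (h2 r (by omega)))
  have hsub : (Set.range fun (i : ℕ) (r : Fin m) => ω (i + r)) ⊆
      Set.range fun (i : ℕ) (r : Fin m) => x (i + r) := by
    rintro _ ⟨j, rfl⟩
    obtain ⟨i, hi, h⟩ := hL j
    refine ⟨i, funext fun r => ?_⟩
    have := r.2
    simp only
    rw [h r r.2, hagree _ (by omega)]
  -- The factors of `ω` of length `m` are factors of `x`, and there are equally many of both, so the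
  -- inclusion is an equality.
  have heq := Set.eq_of_subset_of_ncard_le hsub (hcompl (L + 1) m).le (Set.toFinite _)
  have hmem : (fun r : Fin m => x (i + r)) ∈ Set.range fun (i : ℕ) (r : Fin m) => ω (i + r) :=
    heq ▸ ⟨i, rfl⟩
  obtain ⟨j, hj⟩ := hmem
  exact ⟨j, fun r hr => (congrFun hj ⟨r, hr⟩).symm⟩

theorem block_partialQuotients {s π : ℕ → Substitution A} {k : ℕ → ℕ} (hk : StrictMono k)
    (hπ : ∀ n, π n = block s (k n) (k (n + 1) - k n)) (i n : ℕ) :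
    block π i n = block s (k i) (k (i + n) - k i) := by
  induction n with
  | zero => simp [block_zero]
  | succ n ih =>
    have h1 := hk.monotone (Nat.le_add_right i n)
    have h2 := hk (Nat.lt_succ_self (i + n))
    rw [Nat.succ_eq_add_one] at h2
    rw [block_succ, ih, hπ, ← Nat.add_assoc,
      show k (i + n + 1) - k i = (k (i + n) - k i) + (k (i + n + 1) - k (i + n)) by omega,
      block_add, Nat.add_sub_cancel' h1]

end Substitution

/-! ### Words with equivalent partial quotients -/

namespace ParityAutomaton

variable {d : ℕ} (M : ParityAutomaton d)

/-- If two initial blocks of partial quotients have the same effect on the automaton and end with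
the same letter, then the word can be replaced by an eventually periodically generated one. -/
theorem exists_fixed_of_expansion [Nontrivial (Fin d)] {S : Set (Substitution (Fin d))} {p : ℕ → ℕ}
    (hp : ∀ α ∈ directedWords S, ∀ n, factorComplexity α n = p n)
    {τ π : ℕ → Substitution (Fin d)} {a b : ℕ → Fin d} {α : ℕ → Fin d}
    (hτ : IsCongenialExpansion S τ a α) (hπ : IsPartialQuotients τ a π b) {i j : ℕ} (hij : i < j)
    (hb : b i = b j) (hprof : ∀ e, M.profile ((block π 0 (i + 1)).image e) =
      M.profile ((block π 0 (j + 1)).image e)) :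
    ∃ ω : ℕ → Fin d, (block π (i + 1) (j - i)).Positive ∧
      ((block π (i + 1) (j - i)).image (b i)).head? = some (b i) ∧
      (block π (i + 1) (j - i)).onInfWord ω = ω ∧ ω 0 = b i ∧
      (M.Accepts α ↔ M.Accepts ((block π 0 (i + 1)).onInfWord ω)) := by
  obtain ⟨k, hk, hk0, h⟩ := hπ
  have hkpos : ∀ n, 0 < k (n + 1) := fun n => (Nat.zero_le _).trans_lt (hk (Nat.lt_succ_self n))
  -- Congeniality starts at `σ_1`. The letters are shifted by one, and the first letter of
  -- `σ_0(a_0)` is put in front to obtain a chain from level 0.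
  let c : ℕ → Fin d := fun n => Nat.casesOn n (((τ 0).image (a 0)).head (image_ne_nil _ _)) a
  have hc : IsChain τ c := by
    intro n
    cases n with
    | zero => exact List.head?_eq_some_head _
    | succ n => exact hτ.congenial n
  have hcb : ∀ n, c (k (n + 1)) = b n := by
    intro n
    obtain ⟨r, hr⟩ := Nat.exists_eq_succ_of_ne_zero (hkpos n).ne'
    rw [(h n).2.2.2, hr]
    rfl
  obtain ⟨γ, hγ, hγ0, hγpre⟩ := hc.exists_levels hτ.weaklyPrimitive
  have hαγ : α = γ 0 := by
    refine eq_of_isPrefixOf fun L => ?_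
    obtain ⟨m, hm⟩ := hτ.weaklyPrimitive.exists_length 0 L
    obtain ⟨n, hgen, hn⟩ := ((hτ.generates L).and (eventually_ge_atTop m)).exists
    have hlen := hm (n + 1) (by omega) (a n)
    refine ⟨((block τ 0 (n + 1)).image (a n)).take L, ?_, ?_, ?_⟩
    · rw [List.length_take]
      omega
    · rw [hgen, wordPrefix_eq_seg]
      exact isPrefixOf_seg α L
    · refine IsPrefixOf.of_prefix ?_ (List.take_prefix _ _)
      have := hγpre 0 (n + 1)
      rwa [Nat.zero_add] at this
  have hcov := fun n => hτ.weaklyPrimitive.covering n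
  have hblock := block_partialQuotients hk fun n => (h n).1
  set κ := block π (i + 1) (j - i) with hκdef
  have hκτ : κ = block τ (k (i + 1)) (k (j + 1) - k (i + 1)) := by
    rw [hκdef, hblock, show i + 1 + (j - i) = j + 1 by omega]
  have hkij : k (i + 1) < k (j + 1) := hk (by omega)
  have hκpos : κ.Positive := by
    rw [hκdef, show j - i = (j - i - 1) + 1 by omega, block_succ']
    exact (h (i + 1)).2.1.comp _
  have hκhead : (κ.image (b i)).head? = some (b i) := by
    have := hc.head?_block (k (i + 1)) (k (j + 1) - k (i + 1))
    rwa [Nat.add_sub_cancel' hkij.le, hcb, hcb, ← hκτ, ← hb] at this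
  obtain ⟨ω, hω, hω0, -⟩ := exists_fixed hκpos hκhead
  refine ⟨ω, hκpos, hκhead, hω, hω0, ?_⟩
  have hκW : ∀ α ∈ directedWords S, κ.onInfWord α ∈ directedWords S := by
    intro α hα
    rw [hκτ]
    exact block_onInfWord_mem_directedWords hτ.mem hcov hα _ _
  have hωW : ω ∈ directedWords S := by
    rw [hκτ] at hω hκpos
    exact fixed_mem_directedWords hτ.mem hcov (by omega) hκpos hω
  set β := γ (k (j + 1)) with hβ
  have hβW : β ∈ directedWords S := levels_mem_directedWords hτ.mem hτ.weaklyPrimitive hγ _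
  have hβ0 : β 0 = b i := by rw [hβ, hγ0, hcb, hb]
  have hcomp : block π 0 (j + 1) = (block π 0 (i + 1)).comp κ := by
    rw [hκdef, show j + 1 = (i + 1) + (j - i) by omega, block_add]
    simp
  have hα : α = (block π 0 (j + 1)).onInfWord β := by
    rw [hαγ, hblock, hk0, Nat.sub_zero, Nat.zero_add, hβ]
    have := block_onInfWord_levels hγ 0 (k (j + 1))
    rw [Nat.zero_add] at this
    exact this.symm
  rw [hα, ← M.accepts_onInfWord_congr hprof β]
  refine M.accepts_iff_fixed hκpos (fun e => ?_) hω hκhead hω0 hβ0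
    (exists_factors_subset hκpos hω (hω0.trans hβ0.symm) fun n m => ?_)
  · rw [hprof, hcomp]
  · rw [hp _ (pow_onInfWord_mem hκW hβW n), hp _ hωW]

/-- A bound for the number of pairs of a letter and two families of profiles of words, indexed by
the letters. -/
def pairBound (d q : ℕ) : ℕ := ((q * 2 ^ q) ^ q) ^ d * ((q * 2 ^ q) ^ q) ^ d * d + 1

/-- Pigeonhole: with `q` states there are `(q * 2 ^ q) ^ q` profiles, and a family has one profile
for each of the `d` letters. -/
theorem exists_lt_map_eq {N : ℕ} (hN : pairBound d M.states ≤ N)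
    (f : ℕ → (Fin d → Profile (Fin M.states)) × (Fin d → Profile (Fin M.states)) × Fin d) :
    ∃ i j, i < j ∧ j < N ∧ f i = f j := by
  let e := Profile.equiv (Fin M.states)
  let g : Fin N → (Fin d → Fin M.states → Fin M.states × Finset (Fin M.states)) ×
      (Fin d → Fin M.states → Fin M.states × Finset (Fin M.states)) × Fin d :=
    fun n => (fun x => e ((f n).1 x), fun x => e ((f n).2.1 x), (f n).2.2)
  obtain ⟨i, j, hij, h⟩ := Fintype.exists_ne_map_eq_of_card_lt g (by
    simp only [Fintype.card_prod, Fintype.card_fun, Fintype.card_fin, Fintype.card_finset]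
    rw [← mul_assoc]
    exact hN)
  have hf : f i = f j := by
    simp only [g, Prod.mk.injEq] at h
    refine Prod.ext (funext fun x => e.injective (congrFun h.1 x))
      (Prod.ext (funext fun x => e.injective (congrFun h.2.1 x)) h.2.2)
  rcases lt_or_gt_of_ne (Fin.val_ne_of_ne hij) with hlt | hlt
  · exact ⟨i, j, hlt, j.2, hf⟩
  · exact ⟨j, i, hlt, i.2, hf.symm⟩

/-- Words with equivalent initial partial quotients are not distinguished by the automaton. -/
theorem accepts_iff_of_partialQuotients {S : Set (Substitution (Fin d))} {p : ℕ → ℕ}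
    (hp : ∀ α ∈ directedWords S, ∀ n, factorComplexity α n = p n)
    {F O : Type*} [Semigroup F] [OmegaSemigroup F O] {h : Fin d → F}
    (hrec : Recognises O h {α | M.Accepts α})
    {τ τ' π π' : ℕ → Substitution (Fin d)} {a a' b b' : ℕ → Fin d} {α α' : ℕ → Fin d}
    (hτ : IsCongenialExpansion S τ a α) (hτ' : IsCongenialExpansion S τ' a' α')
    (hπ : IsPartialQuotients τ a π b) (hπ' : IsPartialQuotients τ' a' π' b')
    (heq : ∀ n < pairBound d M.states, SegmentEquiv F (π n) (π' n) ∧ b n = b' n) :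
    M.Accepts α ↔ M.Accepts α' := by
  -- Over at most one letter the two words are equal. With two letters, positivity forces lengths to
  -- grow.
  rcases subsingleton_or_nontrivial (Fin d) with hd | hd
  · rw [Subsingleton.elim α α']
  -- Both expansions enter one pigeonhole argument, so that they are cut at the same indices.
  obtain ⟨i, j, hij, hj, hf⟩ := M.exists_lt_map_eq le_rfl fun n =>
    (fun e => M.profile ((block π 0 (n + 1)).image e),
      fun e => M.profile ((block π' 0 (n + 1)).image e), b n)
  simp only [Prod.mk.injEq] at hf
  obtain ⟨h1, h2, h3⟩ := hf
  have h3' : b' i = b' j := by rw [← (heq i (hij.trans hj)).2, ← (heq j hj).2, h3]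
  obtain ⟨ω, hpos, hhead, hω, hω0, hacc⟩ :=
    M.exists_fixed_of_expansion hp hτ hπ hij h3 (congrFun h1)
  obtain ⟨ω', hpos', -, hω', hω0', hacc'⟩ :=
    M.exists_fixed_of_expansion hp hτ' hπ' hij h3' (congrFun h2)
  have hρ : TailEquiv F (block π 0 (i + 1)) (block π' 0 (i + 1)) :=
    TailEquiv.block fun r hr => (heq (0 + r) (by omega)).1.tailEquiv
  have hκ : TailEquiv F (block π (i + 1) (j - i)) (block π' (i + 1) (j - i)) :=
    TailEquiv.block fun r hr => (heq (i + 1 + r) (by omega)).1.tailEquiv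
  have hval := iprod_fixed_eq (O := O) h hρ hκ hpos hpos' hhead hω hω' hω0 (hω0'.trans (heq i (hij.trans hj)).2.symm)
  obtain ⟨H, hH⟩ := hrec
  rw [hacc, hacc']
  have e1 := hH ((block π 0 (i + 1)).onInfWord ω)
  have e2 := hH ((block π' 0 (i + 1)).onInfWord ω')
  rw [hval] at e1
  exact e1.trans e2.symm

end ParityAutomaton

/-! ### Concatenation and factors of length two -/

namespace Substitution

variable {A : Type*}

/-- The infinite word `x` is the concatenation of the finite word `v` and the infinite word `y`. -/
def IsConcat (v : List A) (y x : ℕ → A) : Prop := ∀ L, IsPrefixOf (v ++ seg y 0 L) x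

theorem IsConcat.apply {v : List A} {y x : ℕ → A} (h : IsConcat v y x) (n : ℕ) :
    x (v.length + n) = y n := by
  have h1 := isPrefixOf_iff.mp (h (n + 1)) (v.length + n) (by simp)
  rw [List.getElem?_append_right (by omega), Nat.add_sub_cancel_left,
    getElem?_seg y (by omega), Nat.zero_add] at h1
  exact Option.some_injective _ h1.symm

theorem IsConcat.onInfWord {v : List A} {y x : ℕ → A} (h : IsConcat v y x) (σ : Substitution A) :
    IsConcat (σ.onWord v) (σ.onInfWord y) (σ.onInfWord x) := by
  intro L
  refine ((h L).onWord σ).of_prefix ?_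
  rw [onWord_append, List.prefix_append_right_inj]
  refine (isPrefixOf_seg _ L).prefix_of_le ((isPrefixOf_seg y L).onWord σ) ?_
  have := σ.length_le_onWord (seg y 0 L)
  simpa using this

/-- If all factors of `β` of length two are factors of `ω`, then the factors of `κⁿ(β)` of a given
length are factors of `ω` for large `n`. -/
theorem exists_factors_subset_of_pairs [Nontrivial A] {κ : Substitution A} (hκ : κ.Positive)
    {ω β : ℕ → A} (hω : κ.onInfWord ω = ω)
    (h : ∀ i, ∃ j, β i = ω j ∧ β (i + 1) = ω (j + 1)) (m : ℕ) :
    ∃ n, ∀ i, ∃ j, ∀ r < m, (κ.pow (n + 1)).onInfWord β (i + r) = ω (j + r) := by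
  -- Images of letters under `κ^(m+1)` are longer than `m`, so a factor of length `m` lies within
  -- the images of two consecutive letters.
  refine ⟨m, fun i => ?_⟩
  set μ := κ.pow (m + 1) with hμ
  obtain ⟨r, hr1, hr2⟩ := (μ.cut_strictMono β).exists_le_lt_succ (μ.cut_zero β) i
  obtain ⟨s, hs1, hs2⟩ := h r
  have hpair : ∀ (α : ℕ → A) (i : ℕ), seg α i (i + 2) = [α i, α (i + 1)] := by
    intro α i
    rw [seg_succ α (by omega), seg_succ_self]
    rfl
  have h1 := μ.seg_cut β (Nat.le_add_right r 2)
  have h2 := μ.seg_cut ω (Nat.le_add_right s 2)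
  have c1 := μ.cut_add β (Nat.le_add_right r 2)
  have c2 := μ.cut_add ω (Nat.le_add_right s 2)
  rw [hμ, pow_onInfWord_of_fixed hω, ← hμ] at h2
  rw [hpair, ← hs1, ← hs2, ← hpair] at h2 c2
  rw [← h1, c1, c2, seg_eq_seg_iff] at h2
  have c3 := μ.cut_add β (Nat.le_succ (r + 1))
  simp only [Nat.succ_eq_add_one, seg_succ_self, onWord_singleton] at c3
  have hlen := hκ.lt_length_pow (m + 1) (β (r + 1))
  rw [← hμ] at hlen
  rw [show r + 1 + 1 = r + 2 by omega] at c3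
  refine ⟨μ.cut ω s + (i - μ.cut β r), fun t ht => ?_⟩
  rw [Nat.add_assoc, h2 (i - μ.cut β r + t) (by omega)]
  congr 1
  omega

end Substitution

/-! ### Sturmian substitutions -/

/-- The substitution `0 ↦ 0^{a-b} 1 0^b`, `1 ↦ 0`. -/
def sturmSubst (a b : ℕ) : Substitution (Fin 2) where
  image x := if x = 0 then List.replicate (a - b) 0 ++ 1 :: List.replicate b 0 else [0]
  image_ne_nil x := by split_ifs <;> simp

theorem sturmSubst_zero (a b : ℕ) :
    (sturmSubst a b).image 0 = List.replicate (a - b) 0 ++ 1 :: List.replicate b 0 := rfl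

theorem sturmSubst_one (a b : ℕ) : (sturmSubst a b).image 1 = [0] := rfl

theorem sturmSubst_covering (a b : ℕ) : (sturmSubst a b).Covering := by
  intro x
  fin_cases x
  · exact ⟨1, by simp [sturmSubst_one]⟩
  · exact ⟨0, by simp [sturmSubst_zero]⟩

/-- One factor alone is not positive, because `1 ↦ 0`. The inner one puts a `0` into every image,
and the outer image of `0` contains both letters. -/
theorem sturmSubst_comp_positive {a b a' b' : ℕ} (ha : 1 ≤ a) (ha' : 1 ≤ a') : ((sturmSubst a b).comp (sturmSubst a' b')).Positive := by
  have h0 : (0 : Fin 2) ∈ (sturmSubst a b).image 0 := by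
    rw [sturmSubst_zero]
    rcases Nat.eq_zero_or_pos b with h | h
    · simp [h]
      omega
    · simp [List.mem_replicate, h.ne']
  have h1 : (1 : Fin 2) ∈ (sturmSubst a b).image 0 := by simp [sturmSubst_zero]
  have h2 : ∀ c, (0 : Fin 2) ∈ (sturmSubst a' b').image c := by
    intro c
    fin_cases c
    · change (0 : Fin 2) ∈ (sturmSubst a' b').image 0
      rw [sturmSubst_zero]
      rcases Nat.eq_zero_or_pos b' with h | h
      · simp [h]
        omega
      · simp [List.mem_replicate, h.ne']
    · exact List.mem_singleton_self _
  intro x c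
  refine mem_onWord.mpr ⟨0, h2 c, ?_⟩
  fin_cases x
  · exact h0
  · exact h1

/-- The two substitutions are conjugate by `0^b`, as one checks on letters. The condition `b ≤ a`
ensures that `a - b` is the true difference. -/
theorem replicate_append_sturmSubst {a b : ℕ} (hb : b ≤ a) (u : List (Fin 2)) :
    List.replicate b 0 ++ (sturmSubst a b).onWord u =
      (sturmSubst a 0).onWord u ++ List.replicate b 0 := by
  induction u with
  | nil => simp
  | cons x u ih =>
    have hx : List.replicate b 0 ++ (sturmSubst a b).image x =
        (sturmSubst a 0).image x ++ List.replicate b 0 := by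
      fin_cases x
      · change List.replicate b 0 ++ (sturmSubst a b).image 0 = (sturmSubst a 0).image 0 ++ _
        rw [sturmSubst_zero, sturmSubst_zero, ← List.append_assoc, List.replicate_append_replicate,
          Nat.add_sub_cancel' hb]
        simp
      · change List.replicate b 0 ++ [0] = [0] ++ List.replicate b 0
        rw [← List.replicate_succ', List.replicate_succ]
        rfl
    rw [onWord_cons, onWord_cons, ← List.append_assoc, hx, List.append_assoc, ih,
      List.append_assoc]

theorem sturmSubst_isConcat {a b : ℕ} (hb : b ≤ a) (z : ℕ → Fin 2) :
    IsConcat (List.replicate b 0) ((sturmSubst a b).onInfWord z) ((sturmSubst a 0).onInfWord z) := by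
  intro L
  have h1 := (isPrefixOf_seg z (L + b)).onWord (sturmSubst a 0)
  have h2 := (isPrefixOf_seg z L).onWord (sturmSubst a b)
  have h3 := (sturmSubst a 0).length_le_onWord (seg z L (L + b))
  have h4 := (sturmSubst a b).length_le_onWord (seg z 0 L)
  have hlen := congrArg List.length (replicate_append_sturmSubst hb (seg z 0 L))
  simp only [length_seg, List.length_append, List.length_replicate] at h3 h4 hlen
  rw [← seg_append z (Nat.zero_le L) (Nat.le_add_right L b), onWord_append] at h1
  have hpre : List.replicate b 0 ++ seg ((sturmSubst a b).onInfWord z) 0 L <+: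
      List.replicate b 0 ++ (sturmSubst a b).onWord (seg z 0 (L + b)) := by
    rw [List.prefix_append_right_inj]
    refine (isPrefixOf_seg _ L).prefix_of_le ((isPrefixOf_seg z (L + b)).onWord _) ?_
    have := (sturmSubst a b).length_le_onWord (seg z 0 (L + b))
    rw [length_seg] at this ⊢
    omega
  rw [replicate_append_sturmSubst hb] at hpre
  have h5 := (isPrefixOf_seg z (L + b)).onWord (sturmSubst a 0)
  refine h5.of_prefix (List.prefix_of_prefix_length_le hpre (List.prefix_append _ _) ?_)
  have := (sturmSubst a 0).length_le_onWord (seg z 0 (L + b))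
  simp only [length_seg, List.length_append, List.length_replicate] at this ⊢
  omega

theorem sturmSubst_apply {a b : ℕ} (hb : b ≤ a) (z : ℕ → Fin 2) (n : ℕ) :
    (sturmSubst a 0).onInfWord z (b + n) = (sturmSubst a b).onInfWord z n := by
  have := (sturmSubst_isConcat hb z).apply n
  rwa [List.length_replicate] at this

/-- Shifts of images under `0 ↦ 0^a 1`, `1 ↦ 0` are images under conjugate substitutions. -/
theorem block_sturmSubst_shift {a b : ℕ → ℕ} (hb : ∀ n, b n ≤ a n) (k : ℕ) (z : ℕ → Fin 2)
    (n : ℕ) : (block (fun i => sturmSubst (a i) 0) 0 k).onInfWord z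
      ((∑ i ∈ Finset.range k, b i * ((block (fun i => sturmSubst (a i) 0) 0 i).image 0).length) + n)
      = (block (fun i => sturmSubst (a i) (b i)) 0 k).onInfWord z n := by
  induction k generalizing z n with
  | zero => simp [block_zero]
  | succ k ih =>
    have h := ((sturmSubst_isConcat (hb k) z).onInfWord
      (block (fun i => sturmSubst (a i) 0) 0 k)).apply
    have hlen : ((block (fun i => sturmSubst (a i) 0) 0 k).onWord
        (List.replicate (b k) 0)).length =
          b k * ((block (fun i => sturmSubst (a i) 0) 0 k).image 0).length := by
      simp [onWord, List.length_flatMap]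
    rw [block_succ, block_succ, comp_onInfWord, comp_onInfWord, Nat.zero_add,
      Finset.sum_range_succ, Nat.add_right_comm, Nat.add_comm, ← hlen, h, ih]

theorem sturmSubst_getElem?_eq_one {a t : ℕ} {x : Fin 2}
    (h : ((sturmSubst a 0).image x)[t]? = some 1) : t + 1 = ((sturmSubst a 0).image x).length := by
  have hlt : t < ((sturmSubst a 0).image x).length := by
    by_contra hge
    rw [List.getElem?_eq_none (not_lt.mp hge)] at h
    simp at h
  rcases (show ∀ x : Fin 2, x = 0 ∨ x = 1 by decide) x with rfl | rfl
  · rw [sturmSubst_zero] at h hlt ⊢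
    simp only [Nat.sub_zero, List.replicate_zero, List.length_append, List.length_replicate,
      List.length_singleton] at h hlt ⊢
    by_contra hne
    rw [List.getElem?_append_left (by rw [List.length_replicate]; omega)] at h
    simp [List.getElem?_replicate] at h
  · rw [sturmSubst_one, List.length_singleton] at hlt ⊢
    omega

theorem sturmSubst_getElem?_zero {a : ℕ} (ha : 1 ≤ a) (x : Fin 2) :
    ((sturmSubst a 0).image x)[0]? = some 0 := by
  rcases (show ∀ x : Fin 2, x = 0 ∨ x = 1 by decide) x with rfl | rfl
  · obtain ⟨a, rfl⟩ := Nat.exists_eq_add_of_le' ha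
    rfl
  · rfl

theorem sturmSubst_cut_getElem? (a : ℕ) (z : ℕ → Fin 2) (r : ℕ) {t : ℕ}
    (ht : t < ((sturmSubst a 0).image (z r)).length) :
    ((sturmSubst a 0).image (z r))[t]? =
      some ((sturmSubst a 0).onInfWord z ((sturmSubst a 0).cut z r + t)) := by
  have hseg := (sturmSubst a 0).seg_cut z (Nat.le_succ r)
  have hcut := (sturmSubst a 0).cut_add z (Nat.le_succ r)
  simp only [Nat.succ_eq_add_one, seg_succ_self, onWord_singleton] at hseg hcut
  rw [← hseg, getElem?_seg _ (by omega)]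

theorem cut_succ {A : Type*} (σ : Substitution A) (z : ℕ → A) (r : ℕ) :
    σ.cut z (r + 1) = σ.cut z r + (σ.image (z r)).length := by
  have := σ.cut_add z (Nat.le_succ r)
  simpa using this

/-- A shift by `b` reduces this to the substitution with `b = 0`. There each `1` ends the image of a
letter, and every image begins with `0` since `a ≥ 1`. -/
theorem sturmSubst_eq_zero_of_eq_one {a b : ℕ} (ha : 1 ≤ a) (hb : b ≤ a) (z : ℕ → Fin 2) (i : ℕ)
    (hi : (sturmSubst a b).onInfWord z i = 1) : (sturmSubst a b).onInfWord z (i + 1) = 0 := by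
  rw [← sturmSubst_apply hb] at hi ⊢
  rw [← Nat.add_assoc]
  generalize b + i = i at hi ⊢
  obtain ⟨r, hr1, hr2⟩ := ((sturmSubst a 0).cut_strictMono z).exists_le_lt_succ
    ((sturmSubst a 0).cut_zero z) i
  rw [cut_succ] at hr2
  have h1 := sturmSubst_cut_getElem? a z r (t := i - (sturmSubst a 0).cut z r) (by omega)
  rw [Nat.add_sub_cancel' hr1, hi] at h1
  have h2 := sturmSubst_getElem?_eq_one h1
  have h3 := sturmSubst_cut_getElem? a z (r + 1) (t := 0) (length_image_pos _ _)
  rw [sturmSubst_getElem?_zero ha, cut_succ, Nat.add_zero] at h3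
  rw [show i + 1 = (sturmSubst a 0).cut z r + ((sturmSubst a 0).image (z r)).length by omega]
  exact Option.some_injective _ h3.symm

/-- The image of `010` under `0 ↦ 0^a 1`, `1 ↦ 0` is `0^a 1 0 0^a 1`. The factors `10`, `00`, `01`
are found from the first `1` on, at distance `a ≥ b` from its beginning, so they survive the shift
by `b`. -/
theorem sturmSubst_exists_pairs {a b : ℕ} (ha : 1 ≤ a) (hb : b ≤ a) {z : ℕ → Fin 2} {i : ℕ}
    (h0 : z i = 0) (h1 : z (i + 1) = 1) (h2 : z (i + 2) = 0) :
    ∀ p : Fin 2 × Fin 2, p ≠ (1, 1) →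
      ∃ j, p.1 = (sturmSubst a b).onInfWord z j ∧ p.2 = (sturmSubst a b).onInfWord z (j + 1) := by
  have c1 := cut_succ (sturmSubst a 0) z i
  have c2 := cut_succ (sturmSubst a 0) z (i + 1)
  have g0 := fun t => sturmSubst_cut_getElem? a z i (t := t)
  have g1 := fun t => sturmSubst_cut_getElem? a z (i + 1) (t := t)
  have g2 := fun t => sturmSubst_cut_getElem? a z (i + 2) (t := t)
  have hlen : ((sturmSubst a 0).image 0).length = a + 1 := by simp [sturmSubst_zero]
  have hlen1 : ((sturmSubst a 0).image 1).length = 1 := rfl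
  have hlast : ((sturmSubst a 0).image 0)[a]? = some 1 := by simp [sturmSubst_zero]
  have hlt : ∀ t < a, ((sturmSubst a 0).image 0)[t]? = some 0 := by
    intro t ht
    rw [sturmSubst_zero, List.getElem?_append_left (by simpa using ht)]
    simp [ht]
  rw [h0, hlen] at c1
  rw [h1, hlen1] at c2
  simp only [h0, h1, h2, hlen, hlen1] at g0 g1 g2
  have e0 := g0 a (by omega)
  have e1 := g1 0 (by omega)
  have e2 := g2 0 (by omega)
  have e3 := g2 (a - 1) (by omega)
  have e4 := g2 a (by omega)
  rw [hlast] at e0 e4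
  rw [hlt _ (by omega)] at e2 e3
  rw [sturmSubst_getElem?_zero ha] at e1
  replace e0 := Option.some_injective _ e0
  replace e1 := Option.some_injective _ e1
  replace e2 := Option.some_injective _ e2
  replace e3 := Option.some_injective _ e3
  replace e4 := Option.some_injective _ e4
  set C := (sturmSubst a 0).cut z i
  rw [show i + 2 = i + 1 + 1 by omega] at e2 e3 e4
  rw [c2, c1] at e2 e3 e4
  rw [c1] at e1
  have key : ∀ x y j, b ≤ j → x = (sturmSubst a 0).onInfWord z j →
      y = (sturmSubst a 0).onInfWord z (j + 1) →
      ∃ j, x = (sturmSubst a b).onInfWord z j ∧ y = (sturmSubst a b).onInfWord z (j + 1) := by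
    intro x y j hj hx hy
    obtain ⟨j, rfl⟩ := Nat.exists_eq_add_of_le hj
    rw [Nat.add_assoc] at hy
    rw [sturmSubst_apply hb] at hx hy
    exact ⟨j, hx, hy⟩
  rintro ⟨x, y⟩ hp
  rcases (show ∀ x y : Fin 2, (x, y) ≠ (1, 1) → (x = 1 ∧ y = 0) ∨ (x = 0 ∧ y = 0) ∨
    (x = 0 ∧ y = 1) by decide) x y hp with ⟨rfl, rfl⟩ | ⟨rfl, rfl⟩ | ⟨rfl, rfl⟩
  · exact key _ _ (C + a) (by omega) e0 e1
  · exact key _ _ (C + (a + 1)) (by omega) e1 e2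
  · refine key _ _ (C + (a + 1) + 1 + (a - 1)) (by omega) e3 ?_
    rw [show C + (a + 1) + 1 + (a - 1) + 1 = C + (a + 1) + 1 + a by omega]
    exact e4

/-- The image of a `0` ends with `1` before the shift. A `0` at a positive position is used so that
this `1` still has a predecessor after the shift by `b`. -/
theorem sturmSubst_exists_eq_one {a b : ℕ} (hb : b ≤ a) {z : ℕ → Fin 2} {i : ℕ}
    (hi : z (i + 1) = 0) : ∃ j, (sturmSubst a b).onInfWord z (j + 1) = 1 := by
  have h := sturmSubst_cut_getElem? a z (i + 1) (t := a) (by rw [hi]; simp [sturmSubst_zero])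
  have hlast : ((sturmSubst a 0).image 0)[a]? = some 1 := by simp [sturmSubst_zero]
  rw [hi, hlast] at h
  have hpos := (sturmSubst a 0).cut_strictMono z (Nat.lt_succ_self i)
  obtain ⟨j, hj⟩ : ∃ j, (sturmSubst a 0).cut z (i + 1) + a = b + (j + 1) := by
    refine ⟨(sturmSubst a 0).cut z (i + 1) + a - b - 1, ?_⟩
    simp only [Nat.succ_eq_add_one] at hpos
    omega
  rw [hj, sturmSubst_apply hb] at h
  exact ⟨j, Option.some_injective _ h.symm⟩

/-- A word that can be desubstituted three times contains the factors `00`, `01` and `10`. -/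
theorem sturmSubst_exists_pairs_of_three {a b : ℕ → ℕ} (ha : ∀ n, 1 ≤ a n) (hb : ∀ n, b n ≤ a n)
    (z : ℕ → Fin 2) (p : Fin 2 × Fin 2) (hp : p ≠ (1, 1)) :
    ∃ j, p.1 = (block (fun i => sturmSubst (a i) (b i)) 0 3).onInfWord z j ∧
      p.2 = (block (fun i => sturmSubst (a i) (b i)) 0 3).onInfWord z (j + 1) := by
  simp only [block_succ', block_zero, comp_onInfWord, id_onInfWord]
  simp only [Nat.zero_add, Nat.reduceAdd]
  set y := (sturmSubst (a 2) (b 2)).onInfWord z with hy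
  set x := (sturmSubst (a 1) (b 1)).onInfWord y with hx
  have hy11 := sturmSubst_eq_zero_of_eq_one (ha 2) (hb 2) z
  have hx11 := sturmSubst_eq_zero_of_eq_one (ha 1) (hb 1) y
  rw [← hy] at hy11
  rw [← hx] at hx11
  have h01 : ∀ x : Fin 2, x = 0 ∨ x = 1 := by decide
  obtain ⟨i, hi⟩ : ∃ i, y (i + 1) = 0 := by
    rcases h01 (y 1) with h | h
    · exact ⟨0, h⟩
    · exact ⟨1, hy11 1 h⟩
  obtain ⟨j, hj⟩ := sturmSubst_exists_eq_one (hb 1) hi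
  rw [← hx] at hj
  refine sturmSubst_exists_pairs (ha 0) (hb 0) (i := j) ?_ hj (hx11 _ hj) p hp
  rcases h01 (x j) with h | h
  · exact h
  · rw [hx11 j h] at hj
    exact absurd hj (by decide)

/-! ### Directive sequences from Ostrowski digits -/

/-- Sequences of digits that arise from continued fractions and Ostrowski expansions; the first
partial quotient is decreased by one. -/
structure IsDigitSequence (a b : ℕ → ℕ) : Prop where
  pos : ∀ n, 1 ≤ a (n + 1)
  le : ∀ n, b n ≤ a n
  eq_zero : ∀ n, b (n + 2) = a (n + 2) → b (n + 1) = 0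

/-- The sequence of Sturmian substitutions determined by sequences of digits. -/
def sturmSeq (a b : ℕ → ℕ) (n : ℕ) : Substitution (Fin 2) := sturmSubst (a n) (b n)

/-- The first letter of the word at level `n ≥ 1`. -/
def sturmLetter (a b : ℕ → ℕ) (n : ℕ) : Fin 2 := if b n = a n then 1 else 0

namespace IsDigitSequence

variable {a b : ℕ → ℕ}

theorem block_positive (h : IsDigitSequence a b) {K l : ℕ} (hK : 1 ≤ K) (hl : 2 ≤ l) :
    (block (sturmSeq a b) K l).Positive := by
  obtain ⟨K, rfl⟩ := Nat.exists_eq_add_of_le' hK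
  obtain ⟨l, rfl⟩ := Nat.exists_eq_add_of_le' hl
  rw [block_succ', block_succ', ← comp_assoc]
  exact (sturmSubst_comp_positive (h.pos K) (h.pos (K + 1))).comp _

/-- The decreased digit `a 0` may vanish, so positivity comes from the two substitutions after the
first one; the first need only be covering. -/
theorem weaklyPrimitive (h : IsDigitSequence a b) : WeaklyPrimitive (sturmSeq a b) := by
  intro n
  refine ⟨n + 2, by omega, ?_⟩
  rw [show n + 2 - n + 1 = 2 + 1 by omega, block_succ']
  exact (sturmSubst_covering _ _).comp_positive (h.block_positive (by omega) le_rfl)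

theorem sturmLetter_eq_zero (h : IsDigitSequence a b) {n : ℕ} (hn : sturmLetter a b (n + 1) = 1) :
    sturmLetter a b (n + 2) = 0 := by
  have hpos := h.pos n
  have hz := h.eq_zero n
  have h1 : b (n + 1) = a (n + 1) := by
    by_contra hne
    rw [sturmLetter, if_neg hne] at hn
    exact absurd hn (by decide)
  rw [sturmLetter, if_neg]
  intro h2
  have := hz h2
  omega

/-- If `b = a` at a level, the image of `0` begins with `1`, and the Ostrowski condition forces the
next letter to be `0`. Otherwise both images begin with `0`. -/
theorem head?_sturmSeq (h : IsDigitSequence a b) (n : ℕ) :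
    ((sturmSeq a b (n + 1)).image (sturmLetter a b (n + 2))).head? =
      some (sturmLetter a b (n + 1)) := by
  have hle := h.le (n + 1)
  by_cases hn : b (n + 1) = a (n + 1)
  · have h1 : sturmLetter a b (n + 1) = 1 := if_pos hn
    rw [h.sturmLetter_eq_zero h1, h1, sturmSeq, sturmSubst_zero, hn]
    simp
  · have h1 : sturmLetter a b (n + 1) = 0 := if_neg hn
    rw [h1, sturmSeq]
    rcases (show ∀ x : Fin 2, x = 0 ∨ x = 1 by decide) (sturmLetter a b (n + 2)) with hx | hx
    · obtain ⟨r, hr⟩ : ∃ r, a (n + 1) - b (n + 1) = r + 1 := ⟨a (n + 1) - b (n + 1) - 1, by omega⟩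
      rw [hx, sturmSubst_zero, hr]
      rfl
    · rw [hx, sturmSubst_one]
      rfl

/-- The words at all levels. -/
theorem exists_levels (h : IsDigitSequence a b) : ∃ γ : ℕ → ℕ → Fin 2,
    (∀ n, (sturmSeq a b n).onInfWord (γ (n + 1)) = γ n) ∧
    (∀ n, γ (n + 1) 0 = sturmLetter a b (n + 1)) ∧
    ∀ n, IsPrefixOf ((block (sturmSeq a b) 0 (n + 1)).image (sturmLetter a b (n + 1))) (γ 0) := by
  let c : ℕ → Fin 2 := fun n => Nat.casesOn n
    (((sturmSeq a b 0).image (sturmLetter a b 1)).head (image_ne_nil _ _))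
    fun n => sturmLetter a b (n + 1)
  have hc : IsChain (sturmSeq a b) c := by
    intro n
    cases n with
    | zero => exact List.head?_eq_some_head _
    | succ n => exact h.head?_sturmSeq n
  obtain ⟨γ, hγ, hγ0, hpre⟩ := hc.exists_levels h.weaklyPrimitive
  refine ⟨γ, hγ, fun n => hγ0 (n + 1), fun n => ?_⟩
  have := hpre 0 (n + 1)
  rwa [Nat.zero_add] at this

end IsDigitSequence

/-! ### Sturmian words with common initial digits -/

namespace ParityAutomaton

variable (M : ParityAutomaton 2)

/-- As for general expansions, with factors of length two in place of the complexity. Since `l ≥ 3`,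
the fixed point can be desubstituted three times and contains `00`, `01`, `10`; the word `γ (K + l)`
does not contain `11`. -/
theorem accepts_iff_fixed_of_digits {a b : ℕ → ℕ} (h : IsDigitSequence a b) {γ : ℕ → ℕ → Fin 2}
    (hγ : ∀ n, (sturmSeq a b n).onInfWord (γ (n + 1)) = γ n)
    (hγ0 : ∀ n, γ (n + 1) 0 = sturmLetter a b (n + 1)) {K l : ℕ} (hK : 1 ≤ K) (hl : 3 ≤ l)
    (hc : sturmLetter a b K = sturmLetter a b (K + l))
    (hprof : ∀ e, M.profile ((block (sturmSeq a b) 0 K).image e) =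
      M.profile ((block (sturmSeq a b) 0 (K + l)).image e))
    {ω : ℕ → Fin 2} (hω : (block (sturmSeq a b) K l).onInfWord ω = ω)
    (hω0 : ω 0 = sturmLetter a b K) :
    M.Accepts (γ 0) ↔ M.Accepts ((block (sturmSeq a b) 0 K).onInfWord ω) := by
  have hpos := h.block_positive hK (show 2 ≤ l by omega)
  have hcomp : block (sturmSeq a b) 0 (K + l) =
      (block (sturmSeq a b) 0 K).comp (block (sturmSeq a b) K l) := by
    rw [block_add, Nat.zero_add]
  have hletter : ∀ n, 1 ≤ n → γ n 0 = sturmLetter a b n := by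
    intro n hn
    obtain ⟨n, rfl⟩ := Nat.exists_eq_add_of_le' hn
    exact hγ0 n
  have hα := block_onInfWord_levels hγ 0 (K + l)
  rw [Nat.zero_add] at hα
  have hhead : ((block (sturmSeq a b) K l).image (sturmLetter a b K)).head? =
      some (sturmLetter a b K) := by
    have h1 := block_onInfWord_levels hγ K l
    have h2 := ((isPrefixOf_singleton (α := γ (K + l))).mpr rfl).onWord (block (sturmSeq a b) K l)
    rw [onWord_singleton, h1, hletter _ (by omega), ← hc, isPrefixOf_iff] at h2
    have h3 := h2 0 (length_image_pos _ _)
    rwa [hletter K hK, ← List.head?_eq_getElem?] at h3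
  rw [← hα, ← M.accepts_onInfWord_congr hprof]
  refine M.accepts_iff_fixed hpos (fun e => by rw [hprof, hcomp]) hω hhead hω0
    ((hletter _ (by omega)).trans hc.symm)
    (exists_factors_subset_of_pairs hpos hω fun i => ?_)
  obtain ⟨z, hz⟩ : ∃ z, (block (sturmSeq a b) K 3).onInfWord z = ω := by
    obtain ⟨l, rfl⟩ := Nat.exists_eq_add_of_le hl
    rw [block_add, comp_onInfWord] at hω
    exact ⟨_, hω⟩
  have hblock : block (sturmSeq a b) K 3 =
      block (fun i => sturmSubst (a (K + i)) (b (K + i))) 0 3 :=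
    block_congr fun r _ => by rw [sturmSeq, Nat.zero_add]
  rw [← hz, hblock]
  have hpos' : ∀ n, 1 ≤ n → 1 ≤ a n := by
    intro n hn
    obtain ⟨n, rfl⟩ := Nat.exists_eq_add_of_le' hn
    exact h.pos n
  refine sturmSubst_exists_pairs_of_three (fun n => hpos' _ (by omega)) (fun n => h.le _) z
    (γ (K + l) i, γ (K + l) (i + 1)) fun hp => ?_
  rw [Prod.mk.injEq, ← hγ (K + l)] at hp
  have h0 := sturmSubst_eq_zero_of_eq_one (hpos' (K + l) (by omega)) (h.le _) _ _ hp.1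
  rw [sturmSeq, h0] at hp
  exact absurd hp.2 (by decide)

/-- Words with the same initial digits are not distinguished by the automaton. -/
theorem accepts_iff_of_digits {a b a' b' : ℕ → ℕ} (h : IsDigitSequence a b)
    (h' : IsDigitSequence a' b') {γ γ' : ℕ → ℕ → Fin 2}
    (hγ : ∀ n, (sturmSeq a b n).onInfWord (γ (n + 1)) = γ n)
    (hγ' : ∀ n, (sturmSeq a' b' n).onInfWord (γ' (n + 1)) = γ' n)
    (hγ0 : ∀ n, γ (n + 1) 0 = sturmLetter a b (n + 1))
    (hγ0' : ∀ n, γ' (n + 1) 0 = sturmLetter a' b' (n + 1))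
    {N : ℕ} (hN : pairBound 2 M.states ≤ N) (heq : ∀ n < 6 * N, a n = a' n ∧ b n = b' n) :
    M.Accepts (γ 0) ↔ M.Accepts (γ' 0) := by
  -- Sampling every third level yields a block of length at least 3, and the offset 1 avoids the
  -- exceptional level 0. One family of profiles suffices, because both words have the same blocks
  -- here; it is entered twice. All levels used lie below `6 * N`.
  obtain ⟨i, j, hij, hj, hf⟩ := M.exists_lt_map_eq hN fun n =>
    (fun e => M.profile ((block (sturmSeq a b) 0 (3 * n + 1)).image e),
      fun e => M.profile ((block (sturmSeq a b) 0 (3 * n + 1)).image e),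
      sturmLetter a b (3 * n + 1))
  simp only [Prod.mk.injEq] at hf
  obtain ⟨h1, -, h3⟩ := hf
  obtain ⟨l, hl⟩ := Nat.exists_eq_add_of_le (show 3 * i + 1 ≤ 3 * j + 1 by omega)
  rw [hl] at h1 h3
  have hletter : ∀ n < 6 * N, sturmLetter a b n = sturmLetter a' b' n := by
    intro n hn
    rw [sturmLetter, sturmLetter, (heq n hn).1, (heq n hn).2]
  have hblock : ∀ k m, k + m ≤ 6 * N → block (sturmSeq a b) k m = block (sturmSeq a' b') k m := by
    intro k m hkm
    refine block_congr fun r hr => ?_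
    rw [sturmSeq, sturmSeq, (heq (k + r) (by omega)).1, (heq (k + r) (by omega)).2]
  have hpos := h.block_positive (show 1 ≤ 3 * i + 1 by omega) (show 2 ≤ l by omega)
  obtain ⟨ω, hω, hω0, -⟩ := exists_fixed hpos (b := sturmLetter a b (3 * i + 1)) (by
    have e1 := block_onInfWord_levels hγ (3 * i + 1) l
    have e2 := ((isPrefixOf_singleton (α := γ (3 * i + 1 + l))).mpr rfl).onWord
      (block (sturmSeq a b) (3 * i + 1) l)
    rw [onWord_singleton, e1, show 3 * i + 1 + l = 3 * i + l + 1 by omega, hγ0,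
      show 3 * i + l + 1 = 3 * i + 1 + l by omega, ← h3, isPrefixOf_iff] at e2
    have e3 := e2 0 (length_image_pos _ _)
    rwa [hγ0, ← List.head?_eq_getElem?] at e3)
  rw [M.accepts_iff_fixed_of_digits h hγ hγ0 (by omega) (by omega) h3 (congrFun h1) hω hω0]
  rw [hblock _ _ (by omega), hblock _ _ (by omega)] at h1
  rw [hblock _ _ (by omega)] at hω ⊢
  rw [hletter _ (by omega), hletter _ (by omega)] at h3
  rw [hletter _ (by omega)] at hω0
  exact (M.accepts_iff_fixed_of_digits h' hγ' hγ0' (by omega) (by omega) h3 (congrFun h1) hω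
    hω0).symm

end ParityAutomaton

theorem Substitution.IsPrefixOf.append {A : Type*} {v w : List A} {α : ℕ → A}
    (hw : IsPrefixOf w α) (hv : seg α w.length (w.length + v.length) = v) :
    IsPrefixOf (w ++ v) α := by
  rw [IsPrefixOf, List.length_append, ← seg_append α (Nat.zero_le _) (Nat.le_add_right _ _), hv,
    hw]

/-! ### Characteristic words -/

/-- The word of slope `η` and intercept `0`. -/
noncomputable def charWord (η : ℝ) (n : ℕ) : Fin 2 :=
  if ⌊((n : ℝ) + 1) * η⌋ < ⌊((n : ℝ) + 2) * η⌋ then 1 else 0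

theorem floor_succ_cases {η : ℝ} (h0 : 0 < η) (h1 : η < 1) (x : ℝ) :
    ⌊(x + 2) * η⌋ = ⌊(x + 1) * η⌋ ∨ ⌊(x + 2) * η⌋ = ⌊(x + 1) * η⌋ + 1 := by
  have e1 : ⌊(x + 1) * η⌋ ≤ ⌊(x + 2) * η⌋ := Int.floor_le_floor (by nlinarith)
  have e2 : ⌊(x + 2) * η⌋ ≤ ⌊(x + 1) * η⌋ + 1 := by
    rw [← Int.floor_add_one]
    exact Int.floor_le_floor (by nlinarith)
  omega

theorem coe_charWord {η : ℝ} (h0 : 0 < η) (h1 : η < 1) (n : ℕ) :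
    ((charWord η n : ℕ) : ℤ) = ⌊((n : ℝ) + 2) * η⌋ - ⌊((n : ℝ) + 1) * η⌋ := by
  rcases floor_succ_cases h0 h1 n with h | h
  · rw [charWord, h, if_neg (lt_irrefl _)]
    simp
  · rw [charWord, h, if_pos (lt_add_one _)]
    simp

/-- The letters 1 of the word of slope `1 / θ` mark the intervals `(n + 1, n + 2]` that contain a
multiple of `θ`. -/
theorem charWord_eq_one {θ : ℝ} (hθ : 0 < θ) {n : ℕ} {j : ℤ} (h1 : (n : ℝ) + 1 < j * θ)
    (h2 : j * θ ≤ (n : ℝ) + 2) : charWord (1 / θ) n = 1 := by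
  refine if_pos (lt_of_lt_of_le (b := j) ?_ ?_)
  · rw [Int.floor_lt, mul_one_div, div_lt_iff₀ hθ]
    exact h1
  · rw [Int.le_floor, mul_one_div, le_div_iff₀ hθ]
    exact h2

theorem charWord_eq_zero {θ : ℝ} (hθ : 0 < θ) {n : ℕ} {j : ℤ} (h1 : j * θ ≤ (n : ℝ) + 1)
    (h2 : (n : ℝ) + 2 < (j + 1) * θ) : charWord (1 / θ) n = 0 := by
  refine if_neg (not_lt.mpr (le_trans (b := j) ?_ ?_))
  · rw [← Int.lt_add_one_iff, Int.floor_lt, mul_one_div, div_lt_iff₀ hθ]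
    exact_mod_cast h2
  · rw [Int.le_floor, mul_one_div, le_div_iff₀ hθ]
    exact h1

/-- Desubstitution of characteristic words. -/
theorem sturmSubst_charWord (a : ℕ) {ζ : ℝ} (hζ : Irrational ζ) (h0 : 0 < ζ) :
    (sturmSubst a 0).onInfWord (charWord (ζ / (1 + ζ))) = charWord (1 / (1 + a + ζ)) := by
  set σ := sturmSubst a 0 with hσ
  set y := charWord (ζ / (1 + ζ)) with hy
  have hpos : 0 < 1 + ζ := by linarith
  have ha : (0 : ℝ) ≤ a := Nat.cast_nonneg a
  have hθ : 0 < 1 + (a : ℝ) + ζ := by linarith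
  have hη0 : 0 < ζ / (1 + ζ) := div_pos h0 hpos
  have hη1 : ζ / (1 + ζ) < 1 := by
    rw [div_lt_one hpos]
    linarith
  have hirr : ∀ v u : ℤ, v ≠ 0 → (v : ℝ) * ζ ≠ u := by
    intro v u hv h
    exact (hζ.intCast_mul hv).ne_int u h
  -- The floor counts the letters 1 among the first `i` letters of `y`. They have images of length
  -- 1, the others images of length `a + 1`.
  suffices H : ∀ i : ℕ, IsPrefixOf (σ.onWord (seg y 0 i)) (charWord (1 / (1 + a + ζ))) ∧
      ((σ.cut y i : ℕ) : ℤ) = i + a * (i - ⌊((i : ℝ) + 1) * (ζ / (1 + ζ))⌋) by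
    refine eq_of_isPrefixOf fun L => ⟨σ.onWord (seg y 0 L), ?_, ?_, (H L).1⟩
    · simpa using σ.length_le_onWord (seg y 0 L)
    · exact (isPrefixOf_seg y L).onWord σ
  intro i
  induction i with
  | zero =>
    refine ⟨by simp [IsPrefixOf], ?_⟩
    have : ⌊ζ / (1 + ζ)⌋ = 0 := Int.floor_eq_zero_iff.mpr ⟨hη0.le, hη1⟩
    simp [this]
  | succ i ih =>
    obtain ⟨ih1, ih2⟩ := ih
    have hcut : σ.cut y i = (σ.onWord (seg y 0 i)).length := rfl
    have hstep := cut_succ σ y i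
    rw [seg_succ y (Nat.zero_le i), onWord_append, onWord_singleton]
    set l := σ.cut y i with hl
    set u := ⌊((i : ℝ) + 1) * (ζ / (1 + ζ))⌋ with hu
    have hlR : (l : ℝ) = i + a * (i - u) := by exact_mod_cast ih2
    have hu1 : (u : ℝ) * (1 + ζ) ≤ (i + 1) * ζ := by
      have := Int.floor_le (((i : ℝ) + 1) * (ζ / (1 + ζ)))
      rwa [← hu, ← mul_div_assoc, le_div_iff₀ hpos] at this
    have hu2 : ((i : ℝ) + 1) * ζ < (u + 1) * (1 + ζ) := by
      have := Int.lt_floor_add_one (((i : ℝ) + 1) * (ζ / (1 + ζ)))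
      rwa [← hu, ← mul_div_assoc, div_lt_iff₀ hpos] at this
    have hvu : u ≤ i := by
      have : (u : ℝ) < i + 1 := by
        by_contra hc
        nlinarith
      exact_mod_cast Int.lt_add_one_iff.mp (by exact_mod_cast this)
    have hne : (((i : ℤ) - u + 1 : ℤ) : ℝ) = i - u + 1 := by push_cast; ring
    have hprod : ((i : ℝ) - u) * (1 + a + ζ) = l - u + (i - u) * ζ := by
      rw [hlR]
      ring
    have hidx : (((i + 1 : ℕ) : ℝ) + 1) = i + 2 := by push_cast; ring
    rw [hidx]
    rcases floor_succ_cases hη0 hη1 i with hfl | hfl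
    · have hyi : y i = 0 := if_neg (by rw [hfl]; exact lt_irrefl _)
      have hlt : ((i : ℝ) + 2) * ζ < (u + 1) * (1 + ζ) := by
        have := Int.lt_floor_add_one (((i : ℝ) + 2) * (ζ / (1 + ζ)))
        rwa [hfl, ← hu, ← mul_div_assoc, div_lt_iff₀ hpos] at this
      -- Irrationality excludes equality, so the next multiple of the inverse slope lies strictly
      -- beyond `l + a + 1` and marks the last letter of the image of `0`.
      have hstrict : (u : ℝ) < (i - u + 1) * ζ := by
        refine lt_of_le_of_ne (by linarith) fun h => ?_
        exact hirr (i - u + 1) u (by omega) (by rw [hne]; exact h.symm)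
      rw [hyi] at hstep ⊢
      have him : σ.image 0 = List.replicate a 0 ++ [1] := rfl
      rw [him, List.length_append, List.length_replicate, List.length_singleton] at hstep
      refine ⟨ih1.append ?_, ?_⟩
      · rw [← hcut, him, List.length_append, List.length_replicate, List.length_singleton,
          ← Nat.add_assoc, seg_succ _ (by omega)]
        congr 1
        · rw [seg_eq_ofFn, ← List.ofFn_const]
          congr 1
          funext r
          have hr : ((r : ℕ) : ℝ) + 1 ≤ a := by exact_mod_cast r.2
          refine charWord_eq_zero hθ (j := i - u) ?_ ?_
          · push_cast
            linarith
          · push_cast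
            linarith
        · congr 1
          refine charWord_eq_one hθ (j := i - u + 1) ?_ ?_
          · push_cast
            linarith
          · push_cast
            linarith
      · rw [hstep, hfl]
        push_cast
        rw [ih2]
        ring
    · have hyi : y i = 1 := if_pos (by rw [hfl]; exact lt_add_one _)
      have hge : ((u : ℝ) + 1) * (1 + ζ) ≤ (i + 2) * ζ := by
        have := Int.floor_le (((i : ℝ) + 2) * (ζ / (1 + ζ)))
        rw [hfl, ← hu, ← mul_div_assoc, le_div_iff₀ hpos] at this
        exact_mod_cast this
      have hstrict : (u : ℝ) + 1 < (i - u + 1) * ζ := by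
        refine lt_of_le_of_ne (by linarith) fun h => ?_
        exact hirr (i - u + 1) (u + 1) (by omega) (by rw [hne, ← h]; push_cast; ring)
      rw [hyi] at hstep ⊢
      have him : σ.image 1 = [0] := rfl
      rw [him, List.length_singleton] at hstep
      refine ⟨ih1.append ?_, ?_⟩
      · rw [← hcut, him, List.length_singleton, seg_succ_self]
        congr 1
        refine charWord_eq_zero hθ (j := i - u) ?_ ?_
        · push_cast
          linarith
        · push_cast
          linarith
      · rw [hstep, hfl]
        push_cast
        rw [ih2]
        ring

/-! ### Continued fractions -/

/-- The complete quotients `0 < ζ_n < 1` of a number in the unit interval. -/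
noncomputable def gaussIter (η : ℝ) (n : ℕ) : ℝ := (fun x : ℝ => Int.fract x⁻¹)^[n] η

theorem gaussIter_succ (η : ℝ) (n : ℕ) : gaussIter η (n + 1) = Int.fract (gaussIter η n)⁻¹ :=
  Function.iterate_succ_apply' _ _ _

theorem gaussIter_mem {η : ℝ} (hη : Irrational η) (h : η ∈ Set.Ioo (0 : ℝ) 1) (n : ℕ) :
    Irrational (gaussIter η n) ∧ gaussIter η n ∈ Set.Ioo (0 : ℝ) 1 := by
  induction n with
  | zero => exact ⟨hη, h⟩
  | succ n ih =>
    have hirr : Irrational (gaussIter η (n + 1)) := by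
      rw [gaussIter_succ, Int.fract]
      exact ih.1.inv.sub_intCast _
    refine ⟨hirr, lt_of_le_of_ne ?_ hirr.ne_zero.symm, ?_⟩
    · rw [gaussIter_succ]
      exact Int.fract_nonneg _
    · rw [gaussIter_succ]
      exact Int.fract_lt_one _

/-- Integer parts affect only the head term. This reconciles the recursion of `GenContFract.of`,
which passes to `(Int.fract v)⁻¹`, with the Gauss map. -/
theorem GenContFract.of_s_fract {v : ℝ} (hv : Int.fract v ≠ 0) (n : ℕ) :
    (GenContFract.of v).s.get? n = (GenContFract.of (Int.fract v)).s.get? n := by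
  cases n with
  | zero =>
    have h := of_s_head (v := Int.fract v) (by rwa [Int.fract_fract])
    rw [Int.fract_fract] at h
    exact (of_s_head hv).trans h.symm
  | succ n => rw [of_s_succ, of_s_succ, Int.fract_fract]

theorem GenContFract.of_s_eq_gaussIter {η : ℝ} (hη : Irrational η) (h : η ∈ Set.Ioo (0 : ℝ) 1)
    (n : ℕ) : (GenContFract.of η).s.get? n = some ⟨1, (⌊(gaussIter η n)⁻¹⌋ : ℝ)⟩ := by
  have hf : Int.fract η = η := Int.fract_eq_self.mpr ⟨h.1.le, h.2⟩
  induction n generalizing η with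
  | zero =>
    have := of_s_head (v := η) (by rw [hf]; exact h.1.ne')
    rwa [hf] at this
  | succ n ih =>
    have h1 := gaussIter_mem hη h 1
    rw [of_s_succ, hf, of_s_fract h1.1.ne_zero]
    exact ih h1.1 h1.2 (Int.fract_fract _)

theorem IsContinuedFraction.eq_floor {η : ℝ} {a : ℕ → ℕ} (ha : IsContinuedFraction η a)
    (hη : Irrational η) (h : η ∈ Set.Ioo (0 : ℝ) 1) (n : ℕ) :
    (a n : ℤ) = ⌊(gaussIter η n)⁻¹⌋ := by
  have h1 := ha.2 n
  have h2 := GenContFract.partDen_eq_s_b (GenContFract.of_s_eq_gaussIter hη h n)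
  rw [h1, Option.some_inj] at h2
  dsimp only at h2
  exact_mod_cast h2

theorem IsContinuedFraction.s_eq {η : ℝ} {a : ℕ → ℕ} (ha : IsContinuedFraction η a)
    (hη : Irrational η) (h : η ∈ Set.Ioo (0 : ℝ) 1) (n : ℕ) :
    (GenContFract.of η).s.get? n = some ⟨1, (a n : ℝ)⟩ := by
  rw [GenContFract.of_s_eq_gaussIter hη h, ← ha.eq_floor hη h]
  simp

/-- The sequence of partial quotients, the first of which is decreased by one. -/
def decrHead (a : ℕ → ℕ) (n : ℕ) : ℕ := if n = 0 then a 0 - 1 else a n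

theorem decrHead_succ (a : ℕ → ℕ) (n : ℕ) : decrHead a (n + 1) = a (n + 1) := rfl

namespace IsContinuedFraction

variable {η : ℝ} {a : ℕ → ℕ}

theorem pos (ha : IsContinuedFraction η a) (hη : Irrational η) (h : η ∈ Set.Ioo (0 : ℝ) 1)
    (n : ℕ) : 1 ≤ a n := by
  have h1 := gaussIter_mem hη h n
  have h2 := ha.eq_floor hη h n
  have h3 : (1 : ℤ) ≤ ⌊(gaussIter η n)⁻¹⌋ := by
    rw [Int.le_floor, Int.cast_one]
    exact (one_le_inv₀ h1.2.1).mpr h1.2.2.le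
  omega

/-- The denominators of the convergents are the lengths of the standard words. -/
theorem dens_eq (ha : IsContinuedFraction η a) (hη : Irrational η) (h : η ∈ Set.Ioo (0 : ℝ) 1)
    (n : ℕ) : (GenContFract.of η).dens n =
      (((block (fun i => sturmSubst (decrHead a i) 0) 0 n).image 0).length : ℝ) := by
  set Q : ℕ → Fin 2 → ℕ := fun n x =>
    ((block (fun i => sturmSubst (decrHead a i) 0) 0 n).image x).length with hQ
  have h0 : ∀ n, Q (n + 1) 0 = decrHead a n * Q n 0 + Q n 1 := by
    intro n
    simp only [hQ]
    rw [block_succ, comp_image, Nat.zero_add, sturmSubst_zero, onWord_append]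
    simp [onWord, List.length_flatMap]
  have h1 : ∀ n, Q (n + 1) 1 = Q n 0 := by
    intro n
    simp only [hQ]
    rw [block_succ, comp_image, Nat.zero_add, sturmSubst_one, onWord_singleton]
  have hs := ha.s_eq hη h
  change _ = (Q n 0 : ℝ)
  induction n using Nat.twoStepInduction with
  | zero => simp [hQ, block_zero]
  | one =>
    -- The image of `1` at level 0 has length 1, where the recurrence for the denominators has 0.
    -- Decreasing the first partial quotient compensates for this.
    have hpos := ha.pos hη h 0
    rw [GenContFract.first_den_eq (hs 0), h0, decrHead, if_pos rfl]
    simp only [hQ, block_zero, id_image, List.length_singleton]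
    norm_cast
    omega
  | more n ih1 ih2 =>
    rw [GenContFract.dens_recurrence (hs (n + 1)) ih1 ih2, h0 (n + 1), h1 n, decrHead_succ]
    push_cast
    ring

theorem exists_nums_eq (ha : IsContinuedFraction η a) (hη : Irrational η)
    (h : η ∈ Set.Ioo (0 : ℝ) 1) (n : ℕ) : ∃ P : ℤ, (GenContFract.of η).nums n = P := by
  have hs := ha.s_eq hη h
  induction n using Nat.twoStepInduction with
  | zero => exact ⟨0, by rw [GenContFract.zeroth_num_eq_h, ha.1]; simp⟩
  | one => exact ⟨1, by rw [GenContFract.first_num_eq (hs 0), ha.1]; simp⟩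
  | more n ih1 ih2 =>
    obtain ⟨P, hP⟩ := ih1
    obtain ⟨P', hP'⟩ := ih2
    refine ⟨a (n + 1) * P' + P, ?_⟩
    rw [GenContFract.nums_recurrence (hs (n + 1)) hP hP']
    push_cast
    ring

/-- Modulo 1, a partial sum is a multiple of `η`. Its coefficient is the shift that occurs in
`block_sturmSubst_shift`, because the `q_i` are lengths of images of `0`. -/
theorem exists_ostrowskiSum_eq (ha : IsContinuedFraction η a) (hη : Irrational η)
    (h : η ∈ Set.Ioo (0 : ℝ) 1) (b : ℕ → ℕ) (k : ℕ) : ∃ P : ℤ, ostrowskiSum η b k =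
      ((∑ i ∈ Finset.range k, b i *
        ((block (fun i => sturmSubst (decrHead a i) 0) 0 i).image 0).length : ℕ) : ℝ) * η - P := by
  choose P hP using ha.exists_nums_eq hη h
  refine ⟨∑ i ∈ Finset.range k, b i * P i, ?_⟩
  rw [ostrowskiSum]
  push_cast
  rw [Finset.sum_mul, ← Finset.sum_sub_distrib]
  refine Finset.sum_congr rfl fun i _ => ?_
  rw [theta, ha.dens_eq hη h, hP]
  ring

/-- The words of slope `η` whose intercepts are the partial sums of an Ostrowski expansion are
shifts of the characteristic word. -/
theorem floor_sub_floor_eq (ha : IsContinuedFraction η a) (hη : Irrational η)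
    (h : η ∈ Set.Ioo (0 : ℝ) 1) (b : ℕ → ℕ) (k m : ℕ) :
    ⌊((m : ℝ) + 2) * η + ostrowskiSum η b k⌋ - ⌊((m : ℝ) + 1) * η + ostrowskiSum η b k⌋ =
      ((charWord η ((∑ i ∈ Finset.range k, b i *
        ((block (fun i => sturmSubst (decrHead a i) 0) 0 i).image 0).length) + m) : ℕ) : ℤ) := by
  obtain ⟨P, hP⟩ := ha.exists_ostrowskiSum_eq hη h b k
  set K := ∑ i ∈ Finset.range k, b i *
        ((block (fun i => sturmSubst (decrHead a i) 0) 0 i).image 0).length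
  rw [coe_charWord h.1 h.2, hP]
  have e : ∀ x : ℝ, (m + x) * η + (K * η - P) = (((K + m : ℕ) : ℝ) + x) * η - P := by
    intro x
    push_cast
    ring
  rw [e, e, Int.floor_sub_intCast, Int.floor_sub_intCast]
  ring

/-- The slope at level `n`. -/
noncomputable def levelSlope (η : ℝ) (n : ℕ) : ℝ :=
  if n = 0 then η else gaussIter η n / (1 + gaussIter η n)

/-- Let `ζ_n` be the complete quotients, so `1/ζ_n = a_n + ζ_{n+1}`. At levels `n ≥ 1` the slope is
`ζ_n/(1 + ζ_n) = 1/(1 + a_n + ζ_{n+1})`. At level 0 it is `1/(a_0 + ζ_1)`, which has the same form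
after `a_0` is decreased by one. -/
theorem charWord_level (ha : IsContinuedFraction η a) (hη : Irrational η)
    (h : η ∈ Set.Ioo (0 : ℝ) 1) (n : ℕ) :
    (sturmSubst (decrHead a n) 0).onInfWord (charWord (levelSlope η (n + 1))) =
      charWord (levelSlope η n) := by
  have h1 := gaussIter_mem hη h n
  have h2 := gaussIter_mem hη h (n + 1)
  have hpos := ha.pos hη h n
  have hinv : (gaussIter η n)⁻¹ = a n + gaussIter η (n + 1) := by
    have h3 := Int.floor_add_fract (gaussIter η n)⁻¹
    rw [← ha.eq_floor hη h n, ← gaussIter_succ] at h3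
    exact_mod_cast h3.symm
  rw [levelSlope, if_neg (Nat.succ_ne_zero n), sturmSubst_charWord _ h2.1 h2.2.1]
  congr 1
  cases n with
  | zero =>
    have h0 : gaussIter η 0 = η := rfl
    rw [h0] at hinv
    rw [levelSlope, if_pos rfl, decrHead, if_pos rfl, Nat.cast_sub hpos, Nat.cast_one,
      add_sub_cancel, ← hinv, one_div, inv_inv]
  | succ n =>
    have hz := h1.2.1
    rw [levelSlope, if_neg (Nat.succ_ne_zero n), decrHead_succ, add_assoc, ← hinv]
    field_simp
    ring

theorem charWord_eq_block (ha : IsContinuedFraction η a) (hη : Irrational η)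
    (h : η ∈ Set.Ioo (0 : ℝ) 1) (n : ℕ) : charWord η =
      (block (fun i => sturmSubst (decrHead a i) 0) 0 n).onInfWord (charWord (levelSlope η n)) := by
  have := block_onInfWord_levels (s := fun i => sturmSubst (decrHead a i) 0)
    (γ := fun n => charWord (levelSlope η n)) (ha.charWord_level hη h) 0 n
  rw [Nat.zero_add] at this
  exact this.symm

/-- The slope is below 1/2, because `ζ < 1`. -/
theorem charWord_levelSlope_zero (hη : Irrational η) (h : η ∈ Set.Ioo (0 : ℝ) 1) (n : ℕ) :
    charWord (levelSlope η (n + 1)) 0 = 0 := by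
  have h1 := (gaussIter_mem hη h (n + 1)).2
  have h0 := h1.1
  have h2 := h1.2
  rw [levelSlope, if_neg (Nat.succ_ne_zero n)]
  set z := gaussIter η (n + 1)
  refine if_neg (not_lt.mpr ?_)
  have hz : 0 ≤ z / (1 + z) := by positivity
  have e : ⌊(((0 : ℕ) : ℝ) + 2) * (z / (1 + z))⌋ = 0 := by
    rw [Int.floor_eq_zero_iff]
    refine ⟨by positivity, ?_⟩
    rw [Nat.cast_zero, zero_add, ← mul_div_assoc, div_lt_one (by linarith)]
    linarith
  rw [e, Int.floor_nonneg]
  positivity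

end IsContinuedFraction

/-! ### From digits to the directive sequence -/

namespace IsSturmianWithDigits

variable {η χ : ℝ} {a b : ℕ → ℕ} {α : ℕ → Fin 2}

theorem isDigitSequence (h : IsSturmianWithDigits η χ a b α) : IsDigitSequence (decrHead a) b where
  pos n := h.continuedFraction.pos h.sturmian.1 h.sturmian.2.1 (n + 1)
  le n := by
    cases n with
    | zero =>
      have := h.ostrowski.first
      rw [decrHead, if_pos rfl]
      omega
    | succ n => exact h.ostrowski.le (n + 1)
  eq_zero n := h.ostrowski.eq_zero (n + 1)

/-- A Sturmian word is generated by the substitutions that correspond to its digits. -/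
theorem exists_levels (h : IsSturmianWithDigits η χ a b α) : ∃ γ : ℕ → ℕ → Fin 2, γ 0 = α ∧
    (∀ n, (sturmSeq (decrHead a) b n).onInfWord (γ (n + 1)) = γ n) ∧
    (∀ n, γ (n + 1) 0 = sturmLetter (decrHead a) b (n + 1)) := by
  have hD := h.isDigitSequence
  have hη := h.sturmian.1
  have hη1 := h.sturmian.2.1
  have hcf := h.continuedFraction
  obtain ⟨γ, hγ, hγ0, hpre⟩ := hD.exists_levels
  refine ⟨γ, ?_, hγ, hγ0⟩
  refine eq_of_isPrefixOf fun L => ⟨seg (γ 0) 0 L, by simp, isPrefixOf_seg _ L, ?_⟩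
  obtain ⟨m, hm⟩ := hD.weaklyPrimitive.exists_length 0 L
  have hev : ∀ᶠ k in atTop, ∀ r ∈ Finset.range L, ((α r : ℕ) : ℤ) =
      ⌊((r : ℝ) + 2) * η + ostrowskiSum η b k⌋ - ⌊((r : ℝ) + 1) * η + ostrowskiSum η b k⌋ :=
    (eventually_all_finset _).mpr fun r _ => h.corresponds r
  obtain ⟨k₀, hk₀⟩ := eventually_atTop.mp hev
  -- The characteristic word at level `k + 1` begins with 0. To compare it with the generated word,
  -- a level is chosen at which the latter begins with 0 too; one of two consecutive levels will do.
  -- Then both words begin with the long image of 0 under the same block.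
  obtain ⟨k, hk, hletter⟩ : ∃ k, max m k₀ ≤ k + 1 ∧ sturmLetter (decrHead a) b (k + 1) = 0 := by
    rcases (show ∀ x : Fin 2, x = 0 ∨ x = 1 by decide)
      (sturmLetter (decrHead a) b (max m k₀ + 1)) with hx | hx
    · exact ⟨max m k₀, by omega, hx⟩
    · exact ⟨max m k₀ + 1, by omega, hD.sturmLetter_eq_zero hx⟩
  have hlen := hm (k + 1) (by omega) 0
  have hα : ∀ r < L, α r =
      (block (sturmSeq (decrHead a) b) 0 (k + 1)).onInfWord
        (charWord (IsContinuedFraction.levelSlope η (k + 1))) r := by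
    intro r hr
    have h1 := hk₀ (k + 1) (by omega) r (Finset.mem_range.mpr hr)
    rw [hcf.floor_sub_floor_eq hη hη1, hcf.charWord_eq_block hη hη1 (k + 1),
      block_sturmSubst_shift hD.le] at h1
    exact Fin.ext (by exact_mod_cast h1)
  have hpre' := ((isPrefixOf_singleton (α := charWord (IsContinuedFraction.levelSlope η (k + 1)))).mpr
    (IsContinuedFraction.charWord_levelSlope_zero hη hη1 k)).onWord
      (block (sturmSeq (decrHead a) b) 0 (k + 1))
  have hγpre := hpre k
  rw [hletter] at hγpre
  rw [onWord_singleton, isPrefixOf_iff] at hpre'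
  rw [isPrefixOf_iff] at hγpre ⊢
  intro r hr
  rw [length_seg, Nat.sub_zero] at hr
  rw [getElem?_seg _ (by omega), Nat.zero_add, hα r hr, ← hpre' r (by omega), hγpre r (by omega)]

end IsSturmianWithDigits

/-! ### Computability of the bound -/

theorem Primrec.nat_pow : Primrec₂ ((· ^ ·) : ℕ → ℕ → ℕ) :=
  Primrec₂.unpaired'.1 Nat.Primrec.pow

/-- The number of partial quotients that determine acceptance. -/
def quotientBound (c : ParityAutomaton.Code) : ℕ := ParityAutomaton.pairBound c.1 c.2.1

theorem computable_quotientBound : Computable quotientBound := by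
  have hd : Primrec fun c : ParityAutomaton.Code => c.1 := Primrec.fst
  have hq : Primrec fun c : ParityAutomaton.Code => c.2.1 := Primrec.fst.comp Primrec.snd
  have hP : Primrec fun c : ParityAutomaton.Code => ((c.2.1 * 2 ^ c.2.1) ^ c.2.1) ^ c.1 :=
    Primrec.nat_pow.comp (Primrec.nat_pow.comp
      (Primrec.nat_mul.comp hq (Primrec.nat_pow.comp (Primrec.const 2) hq)) hq) hd
  exact (Primrec.succ.comp (Primrec.nat_mul.comp (Primrec.nat_mul.comp hP hP) hd)).to_comp

end

theorem mainTheorem4 :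
    ∃ N : ParityAutomaton.Code → ℕ, Computable N ∧
      (∀ (d : ℕ) (M : ParityAutomaton d)
        (S : Set (Substitution (Fin d))) (W : Set (ℕ → Fin d)) (p : ℕ → ℕ),
        (∀ α, α ∈ W ↔ ∃ s : ℕ → Substitution (Fin d),
          (∀ n, s n ∈ S) ∧ Substitution.WeaklyPrimitive s ∧ Substitution.Directs s α) →
        Computable p →
        (∀ α ∈ W, ∀ n, factorComplexity α n = p n) →
        ∀ (F O : Type*) [Finite F] [Finite O] [Semigroup F] [OmegaSemigroup F O] (h : Fin d → F),
        Recognises O h {α | M.Accepts α} →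
        ∀ α ∈ W, ∀ α' ∈ W,
        ∀ (τ τ' π π' : ℕ → Substitution (Fin d)) (a a' b b' : ℕ → Fin d),
        Substitution.IsCongenialExpansion S τ a α →
        Substitution.IsCongenialExpansion S τ' a' α' →
        Substitution.IsPartialQuotients τ a π b →
        Substitution.IsPartialQuotients τ' a' π' b' →
        (∀ n < N M.code, SegmentEquiv F (π n) (π' n) ∧ b n = b' n) →
        (M.Accepts α ↔ M.Accepts α')) ∧
      (∀ (M : ParityAutomaton 2) (η η' χ χ' : ℝ) (a a' b b' : ℕ → ℕ) (α α' : ℕ → Fin 2),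
        IsSturmianWithDigits η χ a b α →
        IsSturmianWithDigits η' χ' a' b' α' →
        (∀ n < 6 * N M.code, a n = a' n ∧ b n = b' n) →
        (M.Accepts α ↔ M.Accepts α')) := by
  refine ⟨quotientBound, computable_quotientBound, ?_, ?_⟩
  · intro d M S W p hW _ hp F O _ _ _ _ h hrec α _ α' _ τ τ' π π' a a' b b' hτ hτ' hπ hπ' heq
    refine M.accepts_iff_of_partialQuotients (p := p) (fun α hα => hp α ?_) hrec hτ hτ' hπ hπ' heq
    exact (hW α).mpr hα
  · intro M η η' χ χ' a a' b b' α α' h h' heq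
    obtain ⟨γ, hγα, hγ, hγ0⟩ := h.exists_levels
    obtain ⟨γ', hγα', hγ', hγ0'⟩ := h'.exists_levels
    rw [← hγα, ← hγα']
    refine M.accepts_iff_of_digits h.isDigitSequence h'.isDigitSequence hγ hγ' hγ0 hγ0' le_rfl
      fun n hn => ⟨?_, (heq n hn).2⟩
    rw [decrHead, decrHead, (heq n hn).1, (heq 0 (Nat.zero_lt_of_lt hn)).1]
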